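/- **Setting.** Coordinates of $\mathbb R^p$ are partitioned into $I$ blocks (views) of sizes $p_1,\dots,p_I$, $p=\sum_i p_i$; $x^k$ is the $k$-th block of a vector $x$ and $A^{k\ell}$ the $(k,\ell)$ block of a $p\times p$ matrix $A$. $\|\cdot\|_2$ is the Euclidean norm of a vector and the Frobenius norm of a matrix, $\langle A,B\rangle=\operatorname{tr}(AB^{\top})$. Let $J_1(x)=\{i:x_i\ne 0\}$, $J_2(x)=\{k:\|x^k\|_2\neq 0\}$. Given weights $w_{k\ell}>0$, put $w_0=\min_{k,\ell} w_{k\ell}$, $w_1=\max_{k,\ell} w_{k\ell}$ and $$\|A\|_{1,1}=\sum_{s,t}|A_{st}|,\quad \|A\|_{1,1}^*=\sum_{k,\ell}w_{k\ell}\|A^{k\ell}\|_2,\quad \|A\|_{\infty,\infty}=\max_{s,t}|A_{st}|,\quad \|A\|_{\infty,\infty}^*=\max_{k,\ell}\frac{\|A^{k\ell}\|_2}{w_{k\ell}}.$$ Let $\Sigma_1=\sum_{j=1}^r\gamma_j v_jv_j^{\top}$ with $v_1,\dots,v_r\in\mathbb R^p$ orthonormal and $\gamma_1>\dots>\gamma_r>0$,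 and put $\gamma_{r+1}=0$. Let $S$ be a symmetric $p\times p$ matrix, $E=S-\Sigma_1$, $\lambda\ge 0$ and $0<\beta\le 1$. **Estimates.** Let $\mathcal F^1=\{H: 0\preceq H\preceq I,\ \operatorname{tr}H=1\}$ ($H$ symmetric) and $\hat\Pi_0=0$. Successively for $j=1,2,\dots$, the $j$-th problem is $$\max\ \langle S,H\rangle-\lambda\beta\|H\|_{1,1}-\lambda(1-\beta)\|H\|_{1,1}^*\quad\text{over } H\in\mathcal F^1 \text{ with } \langle H,\hat\Pi_{j-1}\rangle=0;$$ a $j$-th SIPCA estimate $\hat v_j$ is a unit eigenvector, for the largest eigenvalue, of a maximizer $\hat H_j$, and $\hat\Pi_j=\hat\Pi_{j-1}+\hat v_j\hat v_j^{\top}$. Let $\Pi_j=\sum_{k=1}^{j}v_kv_k^{\top}$, $\epsilon_0=0$ and $\epsilon_j=\max(\|\Pi_j-\hat\Pi_j\|_2,\|\hat v_j-v_j\|_2)$ for $j\ge 1$. **Proposition (deterministic sparsity control).** Fix $r_1\le r$; let $J_1=\bigcup_{j=1}^{r_1}J_1(v_j)$, $J_2=\bigcup_{j=1}^{r_1}J_2(v_j)$,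 $s_1=|J_1|$, $s_2=|J_2|$, and $$b_j=\sum_{k=1}^{j}\frac{4\left[2(\lambda\beta s_1+\lambda(1-\beta)s_2w_1)+2\gamma_k\epsilon_{k-1}+\gamma_1\epsilon_{k-1}^2\right]}{\gamma_k-\gamma_{k+1}},$$ $$\|(\Sigma_1)^{J_2^cJ_2}\|_{2,\infty}^*=\max_{\ell\in J_2^c}\sqrt{\sum_{k\in J_2}\frac{\|(\Sigma_1)^{k\ell}\|_2^2}{w_{k\ell}^2}},\qquad \|(\Sigma_1)_{J_1^cJ_1}\|_{2,\infty}=\max_{t\in J_1^c}\sqrt{\sum_{s\in J_1}(\Sigma_1)_{st}^2}$$ (a maximum over the empty set being $0$). Let $1\le j\le r_1$, let $\hat v_1,\dots,\hat v_{j-1}$ be successive SIPCA estimates (any choice of signs; no assumption if $j=1$), and suppose that for all $1\le i\le j$ $$\mathbb I(\beta\ne 1)\left\{\|E\|_{\infty,\infty}^*+b_i\|(\Sigma_1)^{J_2^cJ_2}\|_{2,\infty}^*\right\}\le\frac{w_0}{w_1}\lambda,$$ $$\frac1\beta\left\{\|E\|_{\infty,\infty}+b_i\|(\Sigma_1)_{J_1^cJ_1}\|_{2,\infty}\right\}\le\lambda,$$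 $$0<\gamma_i-\gamma_{i+1}-4\left(\lambda\beta s_1+\lambda(1-\beta)s_2w_1+\gamma_1b_i\right).$$ (These involve $\hat v_1,\dots,\hat v_{j-1}$ only.) Then the $j$-th problem has exactly one maximizer $\hat H_j$, the $j$-th estimate $\hat v_j$ exists and is unique up to its sign, and $J_1(\hat v_j)\subseteq J_1$, $J_2(\hat v_j)\subseteq J_2$. In particular, if the three conditions hold for all $1\le i\le r_1$, this holds for every $j=1,\dots,r_1$. -/

import Mathlib

open Finset Matrix

noncomputable section

namespace SIPCA

/-- Coordinates of the concatenated vector of `I` data views, the `i`-th view having `p i`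
variables: pairs (view, variable within the view). -/
abbrev Coord {I : ℕ} (p : Fin I → ℕ) : Type := (i : Fin I) × Fin (p i)

/-- Vectors of the concatenated space. -/
abbrev Vec {I : ℕ} (p : Fin I → ℕ) : Type := Coord p → ℝ

/-- Square matrices on the concatenated space. -/
abbrev Mat {I : ℕ} (p : Fin I → ℕ) : Type := Matrix (Coord p) (Coord p) ℝ

/-- Euclidean norm `‖x‖₂` of a vector. -/
def l2norm {m : Type*} [Fintype m] (x : m → ℝ) : ℝ := √(∑ i, x i ^ 2)

/-- Frobenius norm `‖A‖₂` of a matrix. -/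
def frob {m n : Type*} [Fintype m] [Fintype n] (A : Matrix m n ℝ) : ℝ :=
  √(∑ i, ∑ j, A i j ^ 2)

/-- Trace inner product `⟨A, B⟩ = tr(A Bᵀ)`. -/
def inner2 {m : Type*} [Fintype m] (A B : Matrix m m ℝ) : ℝ := (A * Bᵀ).trace

variable {I : ℕ} {p : Fin I → ℕ}

/-- The `k`-th sub-vector `x^k` of `x`. -/
def vecBlock (x : Vec p) (k : Fin I) : Fin (p k) → ℝ := fun s => x ⟨k, s⟩

/-- The `(k, l)`-th block `A^{kl}` of `A`. -/
def matBlock (A : Mat p) (k l : Fin I) : Matrix (Fin (p k)) (Fin (p l)) ℝ :=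
  Matrix.of fun s t => A ⟨k, s⟩ ⟨l, t⟩

/-- Elementwise support `J₁(x)`. -/
def elemSupp (x : Vec p) : Finset (Coord p) := univ.filter fun i => x i ≠ 0

/-- Blockwise support `J₂(x)`. -/
def blockSupp (x : Vec p) : Finset (Fin I) := univ.filter fun k => l2norm (vecBlock x k) ≠ 0

/-- `J₁ = ⋃_{j=1}^{m} J₁(v_j)`. -/
def elemUnion (v : ℕ → Vec p) (m : ℕ) : Finset (Coord p) :=
  (Icc 1 m).biUnion fun j => elemSupp (v j)

/-- `J₂ = ⋃_{j=1}^{m} J₂(v_j)`. -/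
def blockUnion (v : ℕ → Vec p) (m : ℕ) : Finset (Fin I) :=
  (Icc 1 m).biUnion fun j => blockSupp (v j)

/-- `‖A‖_{1,1}`, the sum of the absolute values of the entries. -/
def norm11 (A : Mat p) : ℝ := ∑ s, ∑ t, |A s t|

/-- `‖A‖*_{1,1}`, the weighted sum of the Frobenius norms of the blocks. -/
def norm11Star (w : Fin I → Fin I → ℝ) (A : Mat p) : ℝ :=
  ∑ k, ∑ l, w k l * frob (matBlock A k l)

/-- `‖A‖_{∞,∞}`, the largest absolute value of an entry. -/
def normInf (A : Mat p) : ℝ := ⨆ st : Coord p × Coord p, |A st.1 st.2|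

/-- `‖A‖*_{∞,∞}`, the largest weighted Frobenius norm of a block. -/
def normInfStar (w : Fin I → Fin I → ℝ) (A : Mat p) : ℝ :=
  ⨆ kl : Fin I × Fin I, frob (matBlock A kl.1 kl.2) / w kl.1 kl.2

/-- `w₀`, the smallest weight. -/
def wMin (w : Fin I → Fin I → ℝ) : ℝ := ⨅ kl : Fin I × Fin I, w kl.1 kl.2

/-- `w₁`, the largest weight. -/
def wMax (w : Fin I → Fin I → ℝ) : ℝ := ⨆ kl : Fin I × Fin I, w kl.1 kl.2

/-- `‖A_{J₁ᶜ J₁}‖_{2,∞} = max_{t ∉ J₁} ‖A_{J₁ t}‖₂` (zero if `J₁` is everything). -/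
def offElem (J₁ : Finset (Coord p)) (A : Mat p) : ℝ :=
  ⨆ t : {t : Coord p // t ∉ J₁}, √(∑ s ∈ J₁, A s t ^ 2)

/-- `‖A^{J₂ᶜ J₂}‖*_{2,∞} = max_{l ∉ J₂} (∑_{k ∈ J₂} ‖A^{kl}‖₂² / w_{kl}²)^{1/2}`
(zero if `J₂` is everything). -/
def offBlock (w : Fin I → Fin I → ℝ) (J₂ : Finset (Fin I)) (A : Mat p) : ℝ :=
  ⨆ l : {l : Fin I // l ∉ J₂}, √(∑ k ∈ J₂, frob (matBlock A k l) ^ 2 / w k l ^ 2)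

/-- `∑_{k=1}^{m} u_k u_kᵀ`, the zero matrix for `m = 0`. -/
def proj (u : ℕ → Vec p) (m : ℕ) : Mat p := ∑ k ∈ Icc 1 m, vecMulVec (u k) (u k)

/-- The Fantope of degree one: `0 ⪯ H ⪯ I` and `tr H = 1`. -/
def fantope (p : Fin I → ℕ) : Set (Mat p) :=
  {H | H.PosSemidef ∧ (1 - H).PosSemidef ∧ H.trace = 1}

/-- The deflated Fantope: members of the Fantope with `⟨H, P⟩ = 0`. -/
def deflatedFantope (P : Mat p) : Set (Mat p) := {H | H ∈ fantope p ∧ inner2 H P = 0}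

/-- The penalized objective `⟨S, H⟩ - λ β ‖H‖_{1,1} - λ (1 - β) ‖H‖*_{1,1}`. -/
def objective (S : Mat p) (w : Fin I → Fin I → ℝ) (lam β : ℝ) (H : Mat p) : ℝ :=
  inner2 S H - lam * β * norm11 H - lam * (1 - β) * norm11Star w H

/-- `H` solves the `j`-th problem, that is, maximizes the objective over the Fantope deflated by
the projection `∑_{k=1}^{j-1} v̂_k v̂_kᵀ` on the previous estimates. -/
def IsSolution (S : Mat p) (w : Fin I → Fin I → ℝ) (lam β : ℝ) (vhat : ℕ → Vec p) (j : ℕ)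
    (H : Mat p) : Prop :=
  H ∈ deflatedFantope (proj vhat (j - 1)) ∧
    IsMaxOn (objective S w lam β) (deflatedFantope (proj vhat (j - 1))) H

/-- `u` is a first eigenvector of `H`: a unit eigenvector for the largest eigenvalue. -/
def IsFirstEigenvector (H : Mat p) (u : Vec p) : Prop :=
  l2norm u = 1 ∧ ∃ μ : ℝ, Module.End.HasEigenvector (Matrix.toLin' H) μ u ∧
    ∀ ν : ℝ, Module.End.HasEigenvalue (Matrix.toLin' H) ν → ν ≤ μ

/-- `u` is a `j`-th SIPCA estimate, given the estimates `v̂_1, …, v̂_{j-1}`: a first eigenvector of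
a solution of the `j`-th problem. -/
def IsEstimate (S : Mat p) (w : Fin I → Fin I → ℝ) (lam β : ℝ) (vhat : ℕ → Vec p) (j : ℕ)
    (u : Vec p) : Prop :=
  ∃ H, IsSolution S w lam β vhat j H ∧ IsFirstEigenvector H u

/-- The eigengap `γ_k - γ_{k+1}` for `1 ≤ k ≤ r`, with `γ_{r+1} = 0`. -/
def gap (r : ℕ) (γ : ℕ → ℝ) (k : ℕ) : ℝ := γ k - if k < r then γ (k + 1) else 0

/-- `ε_j = max(‖Π_j - Π̂_j‖₂, ‖v̂_j - v_j‖₂)` for `j ≥ 1`, and `ε_0 = 0`. -/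
def eps (v vhat : ℕ → Vec p) (j : ℕ) : ℝ :=
  if j = 0 then 0 else max (frob (proj v j - proj vhat j)) (l2norm (vhat j - v j))

/-- `b_j = ∑_{k=1}^{j} 4 [2 (λ β s₁ + λ (1-β) s₂ w₁) + 2 γ_k ε_{k-1} + γ_1 ε_{k-1}²]
/ (γ_k - γ_{k+1})`, where `s₁ = |J₁|`, `s₂ = |J₂|`. It involves `v̂_1, …, v̂_{j-1}` only. -/
def bSeq (r : ℕ) (γ : ℕ → ℝ) (v vhat : ℕ → Vec p) (w : Fin I → Fin I → ℝ) (lam β : ℝ)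
    (J₁ : Finset (Coord p)) (J₂ : Finset (Fin I)) (j : ℕ) : ℝ :=
  ∑ k ∈ Icc 1 j,
    4 * (2 * (lam * β * (J₁.card : ℝ) + lam * (1 - β) * (J₂.card : ℝ) * wMax w)
      + 2 * γ k * eps v vhat (k - 1) + γ 1 * eps v vhat (k - 1) ^ 2) / gap r γ k

end SIPCA

end

/-! The proof constructs a primal-dual witness. Confine the j-th problem to matrices supported on J₁
× J₁. Both penalties are maxima of linear forms over a compact convex set of dual variables, so
Sion's theorem (`exists_saddle`) supplies a saddle point (Z, H₀). On J₁ × J₁ the objective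
linearized at Z is ⟨Σ₁ - W, H⟩, where W collects the noise and the dual variables and is bounded as
a bilinear form by K = 2(λβ s₁ + λ(1-β) s₂ w₁).

Let x be a leading unit vector of Σ₁ - W among the vectors supported in J₁ and orthogonal to the
earlier estimates, and let μ be its Rayleigh quotient. A Davis-Kahan type argument
(`Deflation.top_eigenvector`), which also pays for deflating by estimates instead of true
eigenvectors, puts x within b_j of ±v_j. Orthogonally to x and the earlier estimates Σ₁ is then
small (`Deflation.specForm_compl_le`), which leaves a spectral gap.

To leave J₁ × J₁, replace Σ₁ - W by M = Σ₁ - q xᵀ - x qᵀ - W, with q the part of Σ₁ x outside J₁.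
The correction removes the interaction of x with outside coordinates, so M keeps its maximum at x,
with a gap, over all vectors orthogonal to the earlier estimates (`certificate_le`). Since Σ₁ v_j
vanishes outside J₁, the entries of q are at most b_j times the off-support norm of Σ₁; the
elementwise condition then says that the elementwise penalty absorbs S - M outside J₁ × J₁. Hence
the objective is at most ⟨M, ·⟩ ≤ μ on the full deflated Fantope, the last with equality only at x
xᵀ (`deflatedFantope_maximizer`), and the saddle point shows that the objective reaches μ there.

Thus the solution is x xᵀ and the estimate is ±x, supported in J₁ and so in the views of J₂. Strong
induction passes support and orthonormality to the next step. -/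

noncomputable section

open scoped InnerProductSpace

namespace SIPCA

/-! ### Projections and spectral forms of orthonormal families -/

variable {E : Type*} [NormedAddCommGroup E] [InnerProductSpace ℝ E]

/-- The projection `x ↦ ∑_{k ∈ s} ⟪u_k, x⟫ u_k`. -/
def famProj (s : Finset ℕ) (u : ℕ → E) : E →ₗ[ℝ] E :=
  ∑ k ∈ s, (innerₛₗ ℝ (u k)).smulRight (u k)

/-- The bilinear form `∑_{k ∈ s} γ_k ⟪v_k, x⟫ ⟪v_k, y⟫`. -/
def specForm (s : Finset ℕ) (γ : ℕ → ℝ) (v : ℕ → E) (x y : E) : ℝ :=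
  ∑ k ∈ s, γ k * (⟪v k, x⟫_ℝ * ⟪v k, y⟫_ℝ)

/-- `u` is orthonormal on the index set `s`. -/
def OrthonormalFam (s : Finset ℕ) (u : ℕ → E) : Prop :=
  ∀ j ∈ s, ∀ k ∈ s, ⟪u j, u k⟫_ℝ = if j = k then 1 else 0

lemma famProj_apply (s : Finset ℕ) (u : ℕ → E) (x : E) :
    famProj s u x = ∑ k ∈ s, ⟪u k, x⟫_ℝ • u k := by
  simp [famProj, LinearMap.sum_apply]

lemma OrthonormalFam.mono {s t : Finset ℕ} {u : ℕ → E} (h : OrthonormalFam s u) (hts : t ⊆ s) :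
    OrthonormalFam t u := fun j hj k hk => h j (hts hj) k (hts hk)

lemma famProj_eq_zero {s : Finset ℕ} {u : ℕ → E} {x : E} (h : ∀ k ∈ s, ⟪u k, x⟫_ℝ = 0) :
    famProj s u x = 0 := by
  rw [famProj_apply]
  exact Finset.sum_eq_zero fun k hk => by rw [h k hk, zero_smul]

lemma OrthonormalFam.inner_famProj {s : Finset ℕ} {u : ℕ → E} (h : OrthonormalFam s u)
    {k : ℕ} (hk : k ∈ s) (x : E) : ⟪u k, famProj s u x⟫_ℝ = ⟪u k, x⟫_ℝ := by
  rw [famProj_apply, inner_sum, Finset.sum_eq_single k]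
  · rw [inner_smul_right, h k hk k hk]; simp
  · intro b hb hbk
    rw [inner_smul_right, h k hk b hb, if_neg (Ne.symm hbk), mul_zero]
  · exact fun h' => absurd hk h'

lemma inner_famProj_left (s : Finset ℕ) (u : ℕ → E) (x y : E) :
    ⟪famProj s u x, y⟫_ℝ = ∑ k ∈ s, ⟪u k, x⟫_ℝ * ⟪u k, y⟫_ℝ := by
  simp [famProj_apply, sum_inner, inner_smul_left]

lemma OrthonormalFam.norm_famProj_sq {s : Finset ℕ} {u : ℕ → E} (h : OrthonormalFam s u) (x : E) :
    ‖famProj s u x‖ ^ 2 = ∑ k ∈ s, ⟪u k, x⟫_ℝ ^ 2 := by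
  rw [← real_inner_self_eq_norm_sq, inner_famProj_left]
  exact Finset.sum_congr rfl fun k hk => by rw [h.inner_famProj hk, sq]

lemma OrthonormalFam.inner_famProj_self {s : Finset ℕ} {u : ℕ → E} (h : OrthonormalFam s u)
    (x : E) : ⟪famProj s u x, x⟫_ℝ = ‖famProj s u x‖ ^ 2 := by
  rw [h.norm_famProj_sq, inner_famProj_left]
  exact Finset.sum_congr rfl fun k _ => by rw [sq]

lemma OrthonormalFam.norm_sub_famProj_sq {s : Finset ℕ} {u : ℕ → E} (h : OrthonormalFam s u)
    (x : E) : ‖x - famProj s u x‖ ^ 2 = ‖x‖ ^ 2 - ‖famProj s u x‖ ^ 2 := by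
  rw [norm_sub_sq_real, real_inner_comm, h.inner_famProj_self]; ring

lemma OrthonormalFam.norm_famProj_le {s : Finset ℕ} {u : ℕ → E} (h : OrthonormalFam s u) (x : E) :
    ‖famProj s u x‖ ≤ ‖x‖ := by
  have := h.norm_sub_famProj_sq x
  exact le_of_sq_le_sq (by nlinarith [sq_nonneg ‖x - famProj s u x‖]) (norm_nonneg _)

lemma OrthonormalFam.norm_sub_famProj_le {s : Finset ℕ} {u : ℕ → E} (h : OrthonormalFam s u)
    (x : E) : ‖x - famProj s u x‖ ≤ ‖x‖ := by
  have := h.norm_sub_famProj_sq x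
  exact le_of_sq_le_sq (by nlinarith [sq_nonneg ‖famProj s u x‖]) (norm_nonneg _)

lemma specForm_add_left (s : Finset ℕ) (γ : ℕ → ℝ) (v : ℕ → E) (x y z : E) :
    specForm s γ v (x + y) z = specForm s γ v x z + specForm s γ v y z := by
  simp only [specForm, inner_add_right, ← Finset.sum_add_distrib]
  exact Finset.sum_congr rfl fun _ _ => by ring

lemma specForm_comm (s : Finset ℕ) (γ : ℕ → ℝ) (v : ℕ → E) (x y : E) :
    specForm s γ v x y = specForm s γ v y x :=
  Finset.sum_congr rfl fun _ _ => by ring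

lemma specForm_add_right (s : Finset ℕ) (γ : ℕ → ℝ) (v : ℕ → E) (x y z : E) :
    specForm s γ v x (y + z) = specForm s γ v x y + specForm s γ v x z := by
  rw [specForm_comm, specForm_add_left, specForm_comm s γ v y, specForm_comm s γ v z]

lemma specForm_smul_left (s : Finset ℕ) (γ : ℕ → ℝ) (v : ℕ → E) (a : ℝ) (x y : E) :
    specForm s γ v (a • x) y = a * specForm s γ v x y := by
  simp only [specForm, inner_smul_right, Finset.mul_sum]
  exact Finset.sum_congr rfl fun _ _ => by ring

lemma specForm_smul_right (s : Finset ℕ) (γ : ℕ → ℝ) (v : ℕ → E) (a : ℝ) (x y : E) :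
    specForm s γ v x (a • y) = a * specForm s γ v x y := by
  rw [specForm_comm, specForm_smul_left, specForm_comm]

/-- Cauchy-Schwarz on the coefficients. Keeping the projected norms, rather than ‖x‖ and ‖y‖, is
what later yields powers of ε. -/
lemma abs_specForm_le {s : Finset ℕ} {γ : ℕ → ℝ} {v : ℕ → E} (h : OrthonormalFam s v) {G : ℝ}
    (hG : ∀ k ∈ s, |γ k| ≤ G) (hG0 : 0 ≤ G) (x y : E) :
    |specForm s γ v x y| ≤ G * (‖famProj s v x‖ * ‖famProj s v y‖) := by
  have e : ∀ z, ‖famProj s v z‖ = √(∑ k ∈ s, |⟪v k, z⟫_ℝ| ^ 2) := fun z => by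
    simp only [sq_abs]
    rw [← h.norm_famProj_sq, Real.sqrt_sq (norm_nonneg _)]
  calc |specForm s γ v x y| ≤ ∑ k ∈ s, |γ k * (⟪v k, x⟫_ℝ * ⟪v k, y⟫_ℝ)| :=
        Finset.abs_sum_le_sum_abs _ _
    _ ≤ ∑ k ∈ s, G * (|⟪v k, x⟫_ℝ| * |⟪v k, y⟫_ℝ|) := by
        refine Finset.sum_le_sum fun k hk => ?_
        rw [abs_mul, abs_mul]
        exact mul_le_mul_of_nonneg_right (hG k hk) (by positivity)
    _ ≤ _ := by
        rw [← Finset.mul_sum, e, e]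
        exact mul_le_mul_of_nonneg_left (Real.sum_mul_le_sqrt_mul_sqrt _ _ _) hG0

/-! ### Perturbation theory for one deflation step -/

/-- The setting of one deflation step: `v` are the true eigenvectors with eigenvalues `γ`, the
`j`-th one being separated from the later ones by `γ j - γ'`, and the span of `v_1, …, v_{j-1}` is
within `ε` of the span of `u_1, …, u_{j-1}`. -/
structure Deflation (r j : ℕ) (γ : ℕ → ℝ) (γ' ε : ℝ) (v u : ℕ → E) : Prop where
  one_le : 1 ≤ j
  le : j ≤ r
  orth_v : OrthonormalFam (Icc 1 r) v
  orth_u : OrthonormalFam (Icc 1 (j - 1)) u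
  pos : ∀ k ∈ Icc 1 r, 0 < γ k
  le_first : ∀ k ∈ Icc 1 r, γ k ≤ γ 1
  le_mid : ∀ k ∈ Icc j r, γ k ≤ γ j
  le_last : ∀ k ∈ Icc (j + 1) r, γ k ≤ γ'
  last_nonneg : 0 ≤ γ'
  eps_nonneg : 0 ≤ ε
  close : ∀ x, ‖famProj (Icc 1 (j - 1)) v x - famProj (Icc 1 (j - 1)) u x‖ ≤ ε * ‖x‖

namespace Deflation

variable {r j : ℕ} {γ : ℕ → ℝ} {γ' ε : ℝ} {v u : ℕ → E}

lemma specForm_split (h : Deflation r j γ γ' ε v u) (x y : E) :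
    specForm (Icc 1 r) γ v x y
      = specForm (Icc 1 (j - 1)) γ v x y + specForm (Icc j r) γ v x y := by
  have h1 := h.one_le
  have h2 := h.le
  have : Icc 1 r = Icc 1 (j - 1) ∪ Icc j r := by ext k; simp; omega
  rw [specForm, this, Finset.sum_union]
  · rfl
  · rw [Finset.disjoint_left]; intro k; simp; omega

lemma specForm_split_mid (h : Deflation r j γ γ' ε v u) (x y : E) :
    specForm (Icc j r) γ v x y
      = γ j * (⟪v j, x⟫_ℝ * ⟪v j, y⟫_ℝ) + specForm (Icc (j + 1) r) γ v x y := by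
  have h2 := h.le
  have : Icc j r = insert j (Icc (j + 1) r) := by ext k; simp; omega
  rw [specForm, this, Finset.sum_insert (by simp)]
  rfl

lemma orth_low (h : Deflation r j γ γ' ε v u) : OrthonormalFam (Icc 1 (j - 1)) v :=
  h.orth_v.mono (Finset.Icc_subset_Icc_right (by have := h.le; omega))

lemma orth_mid (h : Deflation r j γ γ' ε v u) : OrthonormalFam (Icc j r) v :=
  h.orth_v.mono (Finset.Icc_subset_Icc_left h.one_le)

lemma orth_high (h : Deflation r j γ γ' ε v u) : OrthonormalFam (Icc (j + 1) r) v :=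
  h.orth_v.mono (Finset.Icc_subset_Icc_left (by omega))

lemma mem (h : Deflation r j γ γ' ε v u) : j ∈ Icc 1 r := by
  have h1 := h.one_le
  have h2 := h.le
  simp; omega

lemma norm_v (h : Deflation r j γ γ' ε v u) : ‖v j‖ = 1 := by
  have := h.orth_v j h.mem j h.mem
  rw [real_inner_self_eq_norm_sq, if_pos rfl] at this
  exact (pow_eq_one_iff_of_nonneg (norm_nonneg _) two_ne_zero).1 this

lemma first_nonneg (h : Deflation r j γ γ' ε v u) : 0 ≤ γ 1 :=
  (h.pos j h.mem).le.trans (h.le_first j h.mem)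

lemma abs_low_le (h : Deflation r j γ γ' ε v u) (x y : E) :
    |specForm (Icc 1 (j - 1)) γ v x y|
      ≤ γ 1 * (‖famProj (Icc 1 (j - 1)) v x‖ * ‖famProj (Icc 1 (j - 1)) v y‖) := by
  refine abs_specForm_le h.orth_low (fun k hk => ?_) h.first_nonneg x y
  have hk' : k ∈ Icc 1 r := Finset.Icc_subset_Icc_right (by have := h.le; omega) hk
  rw [abs_of_pos (h.pos k hk')]
  exact h.le_first k hk'

lemma abs_mid_le (h : Deflation r j γ γ' ε v u) (x y : E) :
    |specForm (Icc j r) γ v x y|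
      ≤ γ j * (‖famProj (Icc j r) v x‖ * ‖famProj (Icc j r) v y‖) := by
  refine abs_specForm_le h.orth_mid (fun k hk => ?_) (h.pos j h.mem).le x y
  rw [abs_of_pos (h.pos k (Finset.Icc_subset_Icc_left h.one_le hk))]
  exact h.le_mid k hk

lemma norm_low_le (h : Deflation r j γ γ' ε v u) {x : E}
    (hx : ∀ k ∈ Icc 1 (j - 1), ⟪u k, x⟫_ℝ = 0) :
    ‖famProj (Icc 1 (j - 1)) v x‖ ≤ ε * ‖x‖ := by
  have := h.close x
  rwa [famProj_eq_zero hx, sub_zero] at this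

lemma inner_residual (h : Deflation r j γ γ' ε v u) (x : E) :
    ∀ k ∈ Icc 1 (j - 1), ⟪u k, x - famProj (Icc 1 (j - 1)) u x⟫_ℝ = 0 := fun k hk => by
  rw [inner_sub_right, h.orth_u.inner_famProj hk, sub_self]

/-- The later eigenvectors are orthogonal to the span of the first j - 1, so they see only the
discrepancy between the two projections. -/
lemma norm_mid_famProj_le (h : Deflation r j γ γ' ε v u) (x : E) :
    ‖famProj (Icc j r) v (famProj (Icc 1 (j - 1)) u x)‖ ≤ ε * ‖x‖ := by
  have h0 : famProj (Icc j r) v (famProj (Icc 1 (j - 1)) v x) = 0 := by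
    refine famProj_eq_zero fun k hk => ?_
    rw [famProj_apply, inner_sum]
    refine Finset.sum_eq_zero fun i hi => ?_
    have h2 := h.le
    have h1 := h.one_le
    simp only [Finset.mem_Icc] at hk hi
    rw [inner_smul_right, h.orth_v k (by simp; omega) i (by simp; omega), if_neg (by omega),
      mul_zero]
  have e : famProj (Icc j r) v (famProj (Icc 1 (j - 1)) u x)
      = - famProj (Icc j r) v (famProj (Icc 1 (j - 1)) v x - famProj (Icc 1 (j - 1)) u x) := by
    rw [map_sub, h0]; simp
  rw [e, norm_neg]
  exact (h.orth_mid.norm_famProj_le _).trans (h.close x)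

/-- Deflating by `u` instead of by `v_1, …, v_{j-1}` changes the spectral form only a little. -/
lemma abs_deflated_sub_le (h : Deflation r j γ γ' ε v u) (y z : E) :
    |specForm (Icc 1 r) γ v (y - famProj (Icc 1 (j - 1)) u y) (z - famProj (Icc 1 (j - 1)) u z)
        - specForm (Icc j r) γ v y z|
      ≤ (2 * γ j * ε + γ 1 * ε ^ 2) * (‖y‖ * ‖z‖) := by
  set P := famProj (Icc 1 (j - 1)) u with hP
  have hε := h.eps_nonneg
  have hγ1 := h.first_nonneg
  have hγj := (h.pos j h.mem).le
  have hT : ∀ x, ‖x - P x‖ ≤ ‖x‖ := h.orth_u.norm_sub_famProj_le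
  have low : ∀ x, ‖famProj (Icc 1 (j - 1)) v (x - P x)‖ ≤ ε * ‖x‖ := fun x =>
    (h.norm_low_le (h.inner_residual x)).trans (mul_le_mul_of_nonneg_left (hT x) hε)
  -- Undoing the deflation in each argument costs γ_j ε, twice; the low indices cost γ_1 ε², both
  -- deflated arguments being nearly orthogonal to the low eigenvectors.
  have e1 : specForm (Icc j r) γ v (y - P y) (z - P z) - specForm (Icc j r) γ v y z
      = -specForm (Icc j r) γ v (P y) (z - P z) - specForm (Icc j r) γ v y (P z) := by
    have a1 := specForm_add_left (Icc j r) γ v (y - P y) (P y) (z - P z)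
    have a2 := specForm_add_right (Icc j r) γ v y (z - P z) (P z)
    rw [sub_add_cancel] at a1 a2
    linarith
  have b0 := h.abs_low_le (y - P y) (z - P z)
  have b1 := h.abs_mid_le (P y) (z - P z)
  have b2 := h.abs_mid_le y (P z)
  have c0 : ‖famProj (Icc 1 (j - 1)) v (y - P y)‖ * ‖famProj (Icc 1 (j - 1)) v (z - P z)‖
      ≤ (ε * ‖y‖) * (ε * ‖z‖) :=
    mul_le_mul (low y) (low z) (norm_nonneg _) (by positivity)
  have c1 : ‖famProj (Icc j r) v (P y)‖ * ‖famProj (Icc j r) v (z - P z)‖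
      ≤ (ε * ‖y‖) * ‖z‖ :=
    mul_le_mul (h.norm_mid_famProj_le y) ((h.orth_mid.norm_famProj_le _).trans (hT z))
      (norm_nonneg _) (by positivity)
  have c2 : ‖famProj (Icc j r) v y‖ * ‖famProj (Icc j r) v (P z)‖ ≤ ‖y‖ * (ε * ‖z‖) :=
    mul_le_mul (h.orth_mid.norm_famProj_le _) (h.norm_mid_famProj_le z) (norm_nonneg _)
      (norm_nonneg _)
  have d0 := mul_le_mul_of_nonneg_left c0 hγ1
  have d1 := mul_le_mul_of_nonneg_left c1 hγj
  have d2 := mul_le_mul_of_nonneg_left c2 hγj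
  rw [h.specForm_split, abs_le]
  rw [abs_le] at b0 b1 b2
  constructor <;> nlinarith

lemma high_le (h : Deflation r j γ γ' ε v u) (x : E) :
    specForm (Icc (j + 1) r) γ v x x ≤ γ' * ∑ k ∈ Icc (j + 1) r, ⟪v k, x⟫_ℝ ^ 2 := by
  rw [specForm, Finset.mul_sum]
  refine Finset.sum_le_sum fun k hk => ?_
  rw [← sq]
  exact mul_le_mul_of_nonneg_right (h.le_last k hk) (sq_nonneg _)

/-- By Bessel, the mass not carried by v_j is at most 1 - ⟪v_j, x⟫², and it is weighted by at most
γ'. -/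
lemma mid_le (h : Deflation r j γ γ' ε v u) {x : E} (hx : ‖x‖ = 1) :
    specForm (Icc j r) γ v x x ≤ γ j - (γ j - γ') * (1 - ⟪v j, x⟫_ℝ ^ 2) := by
  have h1 := h.orth_mid.norm_famProj_sq x
  have h2 := h.orth_mid.norm_famProj_le x
  have h3 : Icc j r = insert j (Icc (j + 1) r) := by
    have := h.le
    ext k; simp; omega
  rw [h3, Finset.sum_insert (by simp)] at h1
  have h4 : ∑ k ∈ Icc (j + 1) r, ⟪v k, x⟫_ℝ ^ 2 ≤ 1 - ⟪v j, x⟫_ℝ ^ 2 := by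
    rw [hx] at h2
    rw [← h3] at h1
    nlinarith [norm_nonneg (famProj (Icc j r) v x)]
  have h5 := mul_le_mul_of_nonneg_left h4 h.last_nonneg
  have h6 := h.high_le x
  rw [h.specForm_split_mid]
  nlinarith

/-- The top eigenvalue of the perturbed deflated form is at least `γ_j - D`, and its eigenvectors
are close to `v_j`, up to sign. -/
lemma top_eigenvector (h : Deflation r j γ γ' ε v u) {W : E →ₗ[ℝ] E →ₗ[ℝ] ℝ} {K : ℝ} (hK : 0 ≤ K)
    (hW : ∀ x y, |W x y| ≤ K * (‖x‖ * ‖y‖)) {V : Submodule ℝ E} (hvV : v j ∈ V)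
    (huV : ∀ k ∈ Icc 1 (j - 1), u k ∈ V) {x : E} (hx : ‖x‖ = 1)
    (hxu : ∀ k ∈ Icc 1 (j - 1), ⟪u k, x⟫_ℝ = 0) {μ : ℝ}
    (hμ : specForm (Icc 1 r) γ v x x - W x x = μ)
    (hmax : ∀ y ∈ V, (∀ k ∈ Icc 1 (j - 1), ⟪u k, y⟫_ℝ = 0) →
      specForm (Icc 1 r) γ v y y - W y y ≤ μ * ‖y‖ ^ 2)
    (hgap : 0 < γ j - γ') (hD : K + 2 * γ j * ε + γ 1 * ε ^ 2 < γ j) :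
    γ j - (K + 2 * γ j * ε + γ 1 * ε ^ 2) ≤ μ ∧
      ∃ σ : ℝ, σ ^ 2 = 1 ∧
        (γ j - γ') * ‖x - σ • v j‖ ≤ 4 * (K + 2 * γ j * ε + γ 1 * ε ^ 2) := by
  set P := famProj (Icc 1 (j - 1)) u with hP
  set D := K + 2 * γ j * ε + γ 1 * ε ^ 2 with hDdef
  have hε := h.eps_nonneg
  have hγ1 := h.first_nonneg
  have hγj := (h.pos j h.mem).le
  have hD0 : 0 ≤ D := by positivity
  have hv1 := h.norm_v
  have hT : ∀ x, ‖x - P x‖ ≤ ‖x‖ := h.orth_u.norm_sub_famProj_le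
  -- The total error of treating the deflated perturbed form as the spectral form on the indices ≥
  -- j. It is bilinear, bounded by D, and not assumed symmetric.
  let δ : E → E → ℝ := fun y z => specForm (Icc 1 r) γ v (y - P y) (z - P z)
    - specForm (Icc j r) γ v y z - W (y - P y) (z - P z)
  have hδ : ∀ y z, |δ y z| ≤ D * (‖y‖ * ‖z‖) := fun y z => by
    have a1 := h.abs_deflated_sub_le y z
    have a2 := hW (y - P y) (z - P z)
    have a3 : K * (‖y - P y‖ * ‖z - P z‖) ≤ K * (‖y‖ * ‖z‖) :=
      mul_le_mul_of_nonneg_left (mul_le_mul (hT y) (hT z) (norm_nonneg _) (norm_nonneg _)) hK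
    rw [abs_le] at a1 a2 ⊢
    simp only [δ, hDdef]
    constructor <;> nlinarith
  have hvv : specForm (Icc j r) γ v (v j) (v j) = γ j := by
    rw [specForm, Finset.sum_eq_single j]
    · rw [h.orth_v j h.mem j h.mem]; simp
    · intro k hk hkj
      rw [h.orth_v k (Finset.Icc_subset_Icc_left h.one_le hk) j h.mem, if_neg hkj]; simp
    · intro h'
      exact absurd (Finset.left_mem_Icc.2 h.le) h'
  have hPx : P x = 0 := famProj_eq_zero hxu
  have hy0V : v j - P (v j) ∈ V := by
    refine V.sub_mem hvV ?_
    rw [hP, famProj_apply]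
    exact V.sum_mem fun k hk => V.smul_mem _ (huV k hk)
  have hq := hmax _ hy0V (h.inner_residual (v j))
  have hqe : specForm (Icc 1 r) γ v (v j - P (v j)) (v j - P (v j))
      - W (v j - P (v j)) (v j - P (v j)) = γ j + δ (v j) (v j) := by
    simp only [δ, hvv]; ring
  have hδv := hδ (v j) (v j)
  rw [hv1, abs_le] at hδv
  rw [hqe] at hq
  have hn1 : ‖v j - P (v j)‖ ^ 2 ≤ 1 := by
    have := hT (v j)
    rw [hv1] at this
    nlinarith [norm_nonneg (v j - P (v j))]
  -- The test vector v_j - P v_j may be shorter than 1, so its norm can be dropped from the bound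
  -- only if μ ≥ 0; this is where D < γ_j enters.
  have hμ0 : 0 ≤ μ := by
    by_contra hneg
    push Not at hneg
    nlinarith [sq_nonneg ‖v j - P (v j)‖]
  have hμ1 : γ j + δ (v j) (v j) ≤ μ := by nlinarith
  refine ⟨by linarith, ?_⟩
  have hμx : μ = specForm (Icc j r) γ v x x + δ x x := by
    simp only [δ, hPx, sub_zero, ← hμ]; ring
  have hcurv := h.mid_le hx
  set c := ⟪v j, x⟫_ℝ with hc
  -- The sign making ⟪x, σ v_j⟫ nonnegative, so that x + σ v_j has norm at least 1.
  obtain ⟨σ, hσ, hσc⟩ : ∃ σ : ℝ, σ ^ 2 = 1 ∧ 0 ≤ σ * c := by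
    rcases le_total 0 c with h0 | h0
    · exact ⟨1, by norm_num, by linarith⟩
    · exact ⟨-1, by norm_num, by linarith⟩
  refine ⟨σ, hσ, ?_⟩
  have hin : ⟪x, σ • v j⟫_ℝ = σ * c := by rw [inner_smul_right, real_inner_comm]
  have hnσ : ‖σ • v j‖ ^ 2 = 1 := by
    rw [norm_smul, mul_pow, hv1, Real.norm_eq_abs, sq_abs, hσ]; ring
  have ha : ‖x - σ • v j‖ ^ 2 = 2 - 2 * (σ * c) := by
    rw [norm_sub_sq_real, hin, hnσ, hx]; ring
  have hb : ‖x + σ • v j‖ ^ 2 = 2 + 2 * (σ * c) := by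
    rw [norm_add_sq_real, hin, hnσ, hx]; ring
  have hδadd : ∀ y y' z, δ (y + y') z = δ y z + δ y' z := fun y y' z => by
    have e : y + y' - P (y + y') = (y - P y) + (y' - P y') := by rw [map_add]; abel
    simp only [δ]
    rw [e, specForm_add_left, specForm_add_left, map_add, LinearMap.add_apply]; ring
  have hδadd' : ∀ y z z', δ y (z + z') = δ y z + δ y z' := fun y z z' => by
    have e : z + z' - P (z + z') = (z - P z) + (z' - P z') := by rw [map_add]; abel
    simp only [δ]
    rw [e, specForm_add_right, specForm_add_right, map_add]; ring
  have hδsmul : ∀ (a : ℝ) y z, δ (a • y) z = a * δ y z := fun a y z => by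
    have e : a • y - P (a • y) = a • (y - P y) := by rw [map_smul, smul_sub]
    simp only [δ]
    rw [e, specForm_smul_left, specForm_smul_left, map_smul, LinearMap.smul_apply,
      smul_eq_mul]; ring
  have hδsmul' : ∀ (a : ℝ) y z, δ y (a • z) = a * δ y z := fun a y z => by
    have e : a • z - P (a • z) = a • (z - P z) := by rw [map_smul, smul_sub]
    simp only [δ]
    rw [e, specForm_smul_right, specForm_smul_right, map_smul, smul_eq_mul]; ring
  clear_value δ P D
  -- Polarization bounds the error difference by D A B, while the curvature loss is (γ_j - γ') A² B²
  -- / 4. Cancelling A B gives a bound linear in D, with constant 4.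
  have hdiff : 2 * (δ x x - δ (v j) (v j))
      = δ (x - σ • v j) (x + σ • v j) + δ (x + σ • v j) (x - σ • v j) := by
    have e : x - σ • v j = x + (-σ) • v j := by rw [neg_smul, sub_eq_add_neg]
    rw [e]
    simp only [hδadd, hδadd', hδsmul, hδsmul']
    linear_combination (2 * δ (v j) (v j)) * hσ
  have d1 := hδ (x - σ • v j) (x + σ • v j)
  have d2 := hδ (x + σ • v j) (x - σ • v j)
  rw [abs_le] at d1 d2
  set A := ‖x - σ • v j‖ with hA
  set B := ‖x + σ • v j‖ with hB
  have hA0 : 0 ≤ A := norm_nonneg _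
  have hB1 : 1 ≤ B := le_of_sq_le_sq (by linarith) (norm_nonneg _)
  have hc2 : 4 * (1 - c ^ 2) = A ^ 2 * B ^ 2 := by
    rw [ha, hb]; linear_combination (4 * c ^ 2) * hσ
  have key : (γ j - γ') * (A ^ 2 * B ^ 2) ≤ 4 * D * (A * B) := by
    rw [mul_comm B A] at d2
    have : (γ j - γ') * (1 - c ^ 2) ≤ D * (A * B) := by linarith [d1.2, d2.2]
    rw [← hc2]; linarith
  rcases hA0.eq_or_lt with h0 | h0
  · rw [← h0]; linarith
  · have hAB : 0 < A * B := by positivity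
    have h1 : (γ j - γ') * (A * B) ≤ 4 * D := by
      refine le_of_mul_le_mul_right ?_ hAB
      calc (γ j - γ') * (A * B) * (A * B) = (γ j - γ') * (A ^ 2 * B ^ 2) := by ring
        _ ≤ _ := key
    have h2 : (γ j - γ') * A ≤ (γ j - γ') * (A * B) :=
      mul_le_mul_of_nonneg_left (le_mul_of_one_le_right hA0 hB1) hgap.le
    linarith

/-- On the orthogonal complement of `u_1, …, u_{j-1}` and of a vector close to `v_j`, the spectral
form is essentially bounded by `γ'`. -/
lemma specForm_compl_le (h : Deflation r j γ γ' ε v u) {x y : E} {σ b : ℝ} (hσ : σ ^ 2 = 1)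
    (hb : ‖x - σ • v j‖ ≤ b) (hεb : ε ≤ b)
    (hyu : ∀ k ∈ Icc 1 (j - 1), ⟪u k, y⟫_ℝ = 0) (hyx : ⟪x, y⟫_ℝ = 0) :
    specForm (Icc 1 r) γ v y y ≤ (γ' + 2 * γ 1 * b ^ 2) * ‖y‖ ^ 2 := by
  have hε := h.eps_nonneg
  have hγ1 := h.first_nonneg
  have hb0 : 0 ≤ b := hε.trans hεb
  have a1 := (abs_le.1 (h.abs_low_le y y)).2
  have a2 := h.norm_low_le hyu
  have a3 : ‖famProj (Icc 1 (j - 1)) v y‖ * ‖famProj (Icc 1 (j - 1)) v y‖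
      ≤ (b * ‖y‖) * (b * ‖y‖) := by
    have : ‖famProj (Icc 1 (j - 1)) v y‖ ≤ b * ‖y‖ :=
      a2.trans (mul_le_mul_of_nonneg_right hεb (norm_nonneg _))
    exact mul_le_mul this this (norm_nonneg _) (by positivity)
  have a4 := mul_le_mul_of_nonneg_left a3 hγ1
  -- As y is orthogonal to x, its component along v_j comes only from x - σ v_j.
  have b1 : (σ * ⟪v j, y⟫_ℝ) = -⟪x - σ • v j, y⟫_ℝ := by
    rw [inner_sub_left, hyx, inner_smul_left]; simp
  have b2 : |⟪x - σ • v j, y⟫_ℝ| ≤ b * ‖y‖ :=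
    (abs_real_inner_le_norm _ _).trans (mul_le_mul_of_nonneg_right hb (norm_nonneg _))
  have b3 : ⟪v j, y⟫_ℝ ^ 2 ≤ (b * ‖y‖) ^ 2 := by
    have e : ⟪v j, y⟫_ℝ ^ 2 = |⟪x - σ • v j, y⟫_ℝ| ^ 2 := by
      rw [sq_abs, ← neg_sq ⟪x - σ • v j, y⟫_ℝ, ← b1, mul_pow, hσ, one_mul]
    rw [e]
    exact pow_le_pow_left₀ (abs_nonneg _) b2 2
  have b4 : γ j * ⟪v j, y⟫_ℝ ^ 2 ≤ γ 1 * (b * ‖y‖) ^ 2 :=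
    mul_le_mul (h.le_first j h.mem) b3 (sq_nonneg _) hγ1
  have c1 := h.high_le y
  have c2 : ∑ k ∈ Icc (j + 1) r, ⟪v k, y⟫_ℝ ^ 2 ≤ ‖y‖ ^ 2 := by
    rw [← h.orth_high.norm_famProj_sq]
    exact pow_le_pow_left₀ (norm_nonneg _) (h.orth_high.norm_famProj_le y) 2
  have c3 := mul_le_mul_of_nonneg_left c2 h.last_nonneg
  rw [h.specForm_split, h.specForm_split_mid]
  nlinarith

lemma norm_famProj_v_le (h : Deflation r j γ γ' ε v u) :
    ‖famProj (Icc 1 (j - 1)) u (v j)‖ ≤ ε := by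
  have h0 : famProj (Icc 1 (j - 1)) v (v j) = 0 := famProj_eq_zero fun k hk => by
    have h1 := h.le
    have h2 := h.one_le
    simp only [Finset.mem_Icc] at hk
    rw [h.orth_v k (by simp; omega) j h.mem, if_neg (by omega)]
  have := h.close (v j)
  rwa [h0, zero_sub, norm_neg, h.norm_v, mul_one] at this

end Deflation

end SIPCA

end

noncomputable section

namespace SIPCA

/-! ### Trace inner product, rank one decompositions and the Fantope -/

variable {I : ℕ} {p : Fin I → ℕ}

lemma inner2_eq_sum {m : Type*} [Fintype m] (A B : Matrix m m ℝ) :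
    inner2 A B = ∑ s, ∑ t, A s t * B s t := by
  simp [inner2, Matrix.trace, Matrix.mul_apply]

lemma inner2_vecMulVec {m : Type*} [Fintype m] (A : Matrix m m ℝ) (x y : m → ℝ) :
    inner2 A (vecMulVec x y) = x ⬝ᵥ A *ᵥ y := by
  simp only [inner2_eq_sum, vecMulVec_apply, dotProduct, mulVec, Finset.mul_sum]
  exact Finset.sum_congr rfl fun s _ => Finset.sum_congr rfl fun t _ => by ring

lemma inner2_add_left {m : Type*} [Fintype m] (A B C : Matrix m m ℝ) :
    inner2 (A + B) C = inner2 A C + inner2 B C := by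
  simp [inner2, Matrix.add_mul]

lemma inner2_sub_left {m : Type*} [Fintype m] (A B C : Matrix m m ℝ) :
    inner2 (A - B) C = inner2 A C - inner2 B C := by
  simp [inner2, Matrix.sub_mul]

lemma inner2_smul_left {m : Type*} [Fintype m] (a : ℝ) (A C : Matrix m m ℝ) :
    inner2 (a • A) C = a * inner2 A C := by
  simp [inner2]

lemma inner2_comm {m : Type*} [Fintype m] (A B : Matrix m m ℝ) : inner2 A B = inner2 B A := by
  simp only [inner2_eq_sum, mul_comm]

lemma inner2_add_right {m : Type*} [Fintype m] (A B C : Matrix m m ℝ) :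
    inner2 A (B + C) = inner2 A B + inner2 A C := by
  rw [inner2_comm, inner2_add_left, inner2_comm B, inner2_comm C]

lemma inner2_smul_right {m : Type*} [Fintype m] (a : ℝ) (A C : Matrix m m ℝ) :
    inner2 A (a • C) = a * inner2 A C := by
  rw [inner2_comm, inner2_smul_left, inner2_comm]

lemma inner2_sum_right {m ι : Type*} [Fintype m] (A : Matrix m m ℝ) (s : Finset ι)
    (B : ι → Matrix m m ℝ) : inner2 A (∑ i ∈ s, B i) = ∑ i ∈ s, inner2 A (B i) := by
  simp [inner2, Matrix.transpose_sum, Matrix.mul_sum, Matrix.trace_sum]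

lemma inner2_vecMulVec_self {m : Type*} [Fintype m] (x y : m → ℝ) :
    inner2 (vecMulVec x x) (vecMulVec y y) = (y ⬝ᵥ x) ^ 2 := by
  rw [inner2_vecMulVec, vecMulVec_mulVec, dotProduct_smul, dotProduct_comm x y]
  simp [sq]

/-- A positive semidefinite real matrix is a sum of rank one matrices `b bᵀ`. -/
lemma exists_eq_sum_vecMulVec {m : Type*} [Fintype m] {H : Matrix m m ℝ}
    (hH : H.PosSemidef) : ∃ b : m → m → ℝ, H = ∑ i, vecMulVec (b i) (b i) := by
  classical
  open scoped MatrixOrder in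
  obtain ⟨B, rfl⟩ := CStarAlgebra.nonneg_iff_eq_star_mul_self.mp hH.nonneg
  refine ⟨fun i => B i, ?_⟩
  ext s t
  simp [Matrix.mul_apply, Matrix.sum_apply, vecMulVec_apply, Matrix.star_apply]

lemma trace_sum_vecMulVec {m : Type*} [Fintype m] (b : m → m → ℝ) :
    (∑ i, vecMulVec (b i) (b i)).trace = ∑ i, b i ⬝ᵥ b i := by
  simp [Matrix.trace_sum, Matrix.trace_vecMulVec]

lemma posSemidef_vecMulVec {m : Type*} [Fintype m] (x : m → ℝ) :
    (vecMulVec x x).PosSemidef := by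
  simpa using posSemidef_vecMulVec_self_star x

lemma dotProduct_sq_le {m : Type*} [Fintype m] (x y : m → ℝ) :
    (x ⬝ᵥ y) ^ 2 ≤ (x ⬝ᵥ x) * (y ⬝ᵥ y) := by
  have := Finset.sum_mul_sq_le_sq_mul_sq univ x y
  simpa [dotProduct, sq] using this

lemma dotProduct_mulVec_sum_vecMulVec {m : Type*} [Fintype m] (b : m → m → ℝ) (x : m → ℝ) :
    x ⬝ᵥ (∑ i, vecMulVec (b i) (b i)) *ᵥ x = ∑ i, (x ⬝ᵥ b i) ^ 2 := by
  rw [← inner2_vecMulVec, inner2_comm, inner2_sum_right]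
  exact Finset.sum_congr rfl fun i _ => by rw [inner2_vecMulVec_self, dotProduct_comm]

/-- The bound H ⪯ I is automatic: for H = ∑ b bᵀ, Cauchy-Schwarz gives xᵀHx ≤ (tr H)‖x‖². -/
lemma mem_fantope_iff {H : Mat p} : H ∈ fantope p ↔ H.PosSemidef ∧ H.trace = 1 := by
  refine ⟨fun h => ⟨h.1, h.2.2⟩, fun h => ⟨h.1, ?_, h.2⟩⟩
  refine PosSemidef.of_dotProduct_mulVec_nonneg (isHermitian_one.sub h.1.1) fun x => ?_
  obtain ⟨b, hb⟩ := exists_eq_sum_vecMulVec h.1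
  have ht := h.2
  rw [hb, trace_sum_vecMulVec] at ht
  rw [star_trivial, sub_mulVec, dotProduct_sub, one_mulVec, hb, dotProduct_mulVec_sum_vecMulVec]
  have : ∑ i, (x ⬝ᵥ b i) ^ 2 ≤ ∑ i, (x ⬝ᵥ x) * (b i ⬝ᵥ b i) :=
    Finset.sum_le_sum fun i _ => dotProduct_sq_le _ _
  rw [← Finset.mul_sum, ht, mul_one] at this
  linarith

lemma vecMulVec_mem_fantope {x : Vec p} (hx : x ⬝ᵥ x = 1) : vecMulVec x x ∈ fantope p :=
  mem_fantope_iff.2 ⟨posSemidef_vecMulVec x, by rw [trace_vecMulVec, hx]⟩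

lemma inner2_vecMulVec_proj (x : Vec p) (u : ℕ → Vec p) (m : ℕ) :
    inner2 (vecMulVec x x) (proj u m) = ∑ k ∈ Icc 1 m, (u k ⬝ᵥ x) ^ 2 := by
  rw [proj, inner2_sum_right]
  exact Finset.sum_congr rfl fun k _ => inner2_vecMulVec_self _ _

lemma vecMulVec_mem_deflatedFantope {x : Vec p} (hx : x ⬝ᵥ x = 1) {u : ℕ → Vec p} {m : ℕ}
    (hu : ∀ k ∈ Icc 1 m, u k ⬝ᵥ x = 0) : vecMulVec x x ∈ deflatedFantope (proj u m) := by
  refine ⟨vecMulVec_mem_fantope hx, ?_⟩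
  rw [inner2_vecMulVec_proj]
  exact Finset.sum_eq_zero fun k hk => by rw [hu k hk]; ring

lemma dotProduct_self_sub_sq {m : Type*} [Fintype m] {x : m → ℝ} (hx : x ⬝ᵥ x = 1) (y : m → ℝ) :
    (y - (x ⬝ᵥ y) • x) ⬝ᵥ (y - (x ⬝ᵥ y) • x) = y ⬝ᵥ y - (x ⬝ᵥ y) ^ 2 := by
  simp only [sub_dotProduct, dotProduct_sub, smul_dotProduct, dotProduct_smul, smul_eq_mul, hx,
    dotProduct_comm y x]
  ring

/-- If the quadratic form of `M`, on the orthogonal complement of the `u_k`, is maximal at the unit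
vector `x` with a spectral gap `g`, then `x xᵀ` is the only maximizer of `⟨M, ·⟩` over the deflated
Fantope. -/
lemma deflatedFantope_maximizer {M : Mat p} {u : ℕ → Vec p} {m : ℕ} {x : Vec p} {μ g : ℝ}
    (hg : 0 < g) (hx : x ⬝ᵥ x = 1)
    (hM : ∀ y, (∀ k ∈ Icc 1 m, u k ⬝ᵥ y = 0) →
      y ⬝ᵥ M *ᵥ y ≤ μ * (y ⬝ᵥ y) - g * (y ⬝ᵥ y - (x ⬝ᵥ y) ^ 2))
    {H : Mat p} (hH : H ∈ deflatedFantope (proj u m)) :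
    inner2 M H ≤ μ ∧ (μ ≤ inner2 M H → H = vecMulVec x x) := by
  obtain ⟨hF, h0⟩ := hH
  obtain ⟨hP, ht⟩ := mem_fantope_iff.1 hF
  obtain ⟨b, rfl⟩ := exists_eq_sum_vecMulVec hP
  rw [trace_sum_vecMulVec] at ht
  -- ⟨H, P⟩ = 0 is a vanishing sum of squares, so every rank one piece of H inherits the
  -- orthogonality to the u_k.
  have hbu : ∀ i, ∀ k ∈ Icc 1 m, u k ⬝ᵥ b i = 0 := by
    rw [inner2_comm, inner2_sum_right,
      Finset.sum_eq_zero_iff_of_nonneg fun i _ => by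
        rw [inner2_comm, inner2_vecMulVec_proj]; positivity] at h0
    intro i k hk
    have h1 := h0 i (mem_univ i)
    rw [inner2_comm, inner2_vecMulVec_proj,
      Finset.sum_eq_zero_iff_of_nonneg fun _ _ => sq_nonneg _] at h1
    exact pow_eq_zero_iff two_ne_zero |>.1 (h1 k hk)
  have hle : ∀ i, b i ⬝ᵥ M *ᵥ b i
      ≤ μ * (b i ⬝ᵥ b i) - g * (b i ⬝ᵥ b i - (x ⬝ᵥ b i) ^ 2) := fun i => hM _ (hbu i)
  have hnn : ∀ i, 0 ≤ b i ⬝ᵥ b i - (x ⬝ᵥ b i) ^ 2 := fun i => by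
    rw [← dotProduct_self_sub_sq hx]; exact dotProduct_self_star_nonneg _
  have hsum : inner2 M (∑ i, vecMulVec (b i) (b i))
      ≤ μ - g * ∑ i, (b i ⬝ᵥ b i - (x ⬝ᵥ b i) ^ 2) := by
    rw [inner2_sum_right, Finset.mul_sum]
    calc _ ≤ ∑ i, (μ * (b i ⬝ᵥ b i) - g * (b i ⬝ᵥ b i - (x ⬝ᵥ b i) ^ 2)) :=
          Finset.sum_le_sum fun i _ => by rw [inner2_vecMulVec]; exact hle i
      _ = _ := by rw [Finset.sum_sub_distrib, ← Finset.mul_sum, ht, mul_one]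
  have hs0 : 0 ≤ ∑ i, (b i ⬝ᵥ b i - (x ⬝ᵥ b i) ^ 2) := Finset.sum_nonneg fun i _ => hnn i
  refine ⟨by nlinarith, fun hμ => ?_⟩
  have hz : ∑ i, (b i ⬝ᵥ b i - (x ⬝ᵥ b i) ^ 2) = 0 := le_antisymm (by nlinarith) hs0
  rw [Finset.sum_eq_zero_iff_of_nonneg fun i _ => hnn i] at hz
  have hb : ∀ i, b i = (x ⬝ᵥ b i) • x := fun i => by
    have := hz i (mem_univ i)
    rw [← dotProduct_self_sub_sq hx, dotProduct_self_eq_zero] at this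
    exact sub_eq_zero.1 this
  have hc : ∑ i, (x ⬝ᵥ b i) ^ 2 = 1 := by
    rw [← ht]
    exact Finset.sum_congr rfl fun i _ => by linarith [hz i (mem_univ i)]
  calc ∑ i, vecMulVec (b i) (b i) = ∑ i, (x ⬝ᵥ b i) ^ 2 • vecMulVec x x := by
        refine Finset.sum_congr rfl fun i _ => ?_
        conv_lhs => rw [hb i]
        rw [smul_vecMulVec, vecMulVec_smul, smul_smul, sq]
    _ = vecMulVec x x := by rw [← Finset.sum_smul, hc, one_smul]

/-! ### Compactness and convexity of the restricted Fantope -/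

/-- The members of the deflated Fantope supported on `J₁ × J₁`. -/
def restrictedFantope (J₁ : Finset (Coord p)) (P : Mat p) : Set (Mat p) :=
  {H | H ∈ deflatedFantope P ∧ ∀ s t, s ∉ J₁ ∨ t ∉ J₁ → H s t = 0}

lemma abs_apply_le_of_mem_fantope {H : Mat p} (hH : H ∈ fantope p) (s t : Coord p) :
    |H s t| ≤ 1 := by
  obtain ⟨hP, ht⟩ := mem_fantope_iff.1 hH
  obtain ⟨b, rfl⟩ := exists_eq_sum_vecMulVec hP
  rw [trace_sum_vecMulVec] at ht
  rw [Matrix.sum_apply, ← ht]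
  refine (Finset.abs_sum_le_sum_abs _ _).trans (Finset.sum_le_sum fun i _ => ?_)
  have h : ∀ s, b i s ^ 2 ≤ b i ⬝ᵥ b i := fun s => by
    rw [dotProduct, sq]
    exact Finset.single_le_sum (f := fun s => b i s * b i s) (fun s _ => mul_self_nonneg _)
      (mem_univ s)
  rw [vecMulVec_apply, abs_le]
  constructor <;> nlinarith [h s, h t, sq_nonneg (b i s + b i t), sq_nonneg (b i s - b i t)]

lemma continuous_apply_mat (s t : Coord p) : Continuous fun H : Mat p => H s t :=
  continuous_id.matrix_elem s t

lemma continuous_inner2_right (A : Mat p) : Continuous fun H : Mat p => inner2 A H := by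
  simp only [inner2_eq_sum]
  exact continuous_finsetSum _ fun s _ => continuous_finsetSum _ fun t _ =>
    continuous_const.mul (continuous_apply_mat s t)

lemma isCompact_of_isClosed_of_abs_le {K : Set (Mat p)} (hK : IsClosed K) {C : ℝ}
    (hC : ∀ H ∈ K, ∀ s t, |H s t| ≤ C) : IsCompact K := by
  have h : IsCompact (Set.univ.pi fun _ : Coord p =>
      Set.univ.pi fun _ : Coord p => Set.Icc (-C) C) :=
    isCompact_univ_pi fun _ => isCompact_univ_pi fun _ => isCompact_Icc
  exact h.of_isClosed_subset hK fun H hH s _ t _ => abs_le.1 (hC H hH s t)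

lemma isClosed_restrictedFantope (J₁ : Finset (Coord p)) (P : Mat p) :
    IsClosed (restrictedFantope J₁ P) := by
  -- Every condition becomes a linear equation or a weak linear inequality in H, semidefiniteness
  -- being tested on rank one matrices.
  have e : restrictedFantope J₁ P = {H | (∀ s t, H s t = H t s)} ∩
      {H | ∀ x : Vec p, 0 ≤ inner2 (vecMulVec x x) H} ∩ {H | inner2 1 H = 1} ∩
      {H | inner2 P H = 0} ∩ {H | ∀ s t, s ∉ J₁ ∨ t ∉ J₁ → H s t = 0} := by
    ext H
    simp only [restrictedFantope, deflatedFantope, Set.mem_ofPred_eq, Set.mem_inter_iff,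
      mem_fantope_iff, inner2_comm P H]
    have h1 : inner2 1 H = H.trace := by simp [inner2]
    have h2 : H.PosSemidef ↔ (∀ s t, H s t = H t s) ∧
        ∀ x : Vec p, 0 ≤ inner2 (vecMulVec x x) H := by
      rw [posSemidef_iff_dotProduct_mulVec]
      refine and_congr ?_ ?_
      · rw [IsHermitian, conjTranspose_eq_transpose_of_trivial, ← Matrix.ext_iff]
        exact ⟨fun h s t => h t s, fun h s t => h t s⟩
      · simp only [inner2_comm _ H, inner2_vecMulVec, star_trivial]
    rw [h1, h2]
  rw [e]
  refine (((IsClosed.inter ?_ ?_).inter ?_).inter ?_).inter ?_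
  · simp only [Set.ofPred_forall]
    exact isClosed_iInter fun s => isClosed_iInter fun t =>
      isClosed_eq (continuous_apply_mat s t) (continuous_apply_mat t s)
  · simp only [Set.ofPred_forall]
    exact isClosed_iInter fun x => isClosed_le continuous_const (continuous_inner2_right _)
  · exact isClosed_eq (continuous_inner2_right _) continuous_const
  · exact isClosed_eq (continuous_inner2_right _) continuous_const
  · simp only [Set.ofPred_forall]
    exact isClosed_iInter fun s => isClosed_iInter fun t => isClosed_iInter fun _ =>
      isClosed_eq (continuous_apply_mat s t) continuous_const

lemma isCompact_restrictedFantope (J₁ : Finset (Coord p)) (P : Mat p) :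
    IsCompact (restrictedFantope J₁ P) :=
  isCompact_of_isClosed_of_abs_le (isClosed_restrictedFantope J₁ P)
    fun _ hH => abs_apply_le_of_mem_fantope hH.1.1

lemma convex_restrictedFantope (J₁ : Finset (Coord p)) (P : Mat p) :
    Convex ℝ (restrictedFantope J₁ P) := by
  rintro H ⟨⟨hH, hHP⟩, hHJ⟩ K ⟨⟨hK, hKP⟩, hKJ⟩ a b ha hb hab
  rw [mem_fantope_iff] at hH hK
  refine ⟨⟨mem_fantope_iff.2 ⟨(hH.1.smul ha).add (hK.1.smul hb), ?_⟩, ?_⟩, fun s t hst => ?_⟩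
  · rw [trace_add, trace_smul, trace_smul, hH.2, hK.2]; simpa using hab
  · rw [inner2_add_left, inner2_smul_left, inner2_smul_left, hHP, hKP]; ring
  · simp [hHJ s t hst, hKJ s t hst]

/-! ### Dual variables and the saddle point -/

/-- The dual variables of the two penalties, supported on `J₁ × J₁`. -/
def dualBall (w : Fin I → Fin I → ℝ) (J₁ : Finset (Coord p)) : Set (Mat p × Mat p) :=
  {Z | (∀ s t, |Z.1 s t| ≤ 1) ∧ (∀ k l, frob (matBlock Z.2 k l) ≤ w k l) ∧
    ∀ s t, s ∉ J₁ ∨ t ∉ J₁ → Z.1 s t = 0 ∧ Z.2 s t = 0}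

lemma frob_nonneg {m n : Type*} [Fintype m] [Fintype n] (A : Matrix m n ℝ) : 0 ≤ frob A :=
  Real.sqrt_nonneg _

lemma frob_sq {m n : Type*} [Fintype m] [Fintype n] (A : Matrix m n ℝ) :
    frob A ^ 2 = ∑ i, ∑ j, A i j ^ 2 :=
  Real.sq_sqrt (by positivity)

lemma frob_le_iff {m n : Type*} [Fintype m] [Fintype n] {A : Matrix m n ℝ} {c : ℝ} (hc : 0 ≤ c) :
    frob A ≤ c ↔ ∑ i, ∑ j, A i j ^ 2 ≤ c ^ 2 :=
  Real.sqrt_le_left hc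

lemma abs_apply_le_frob {m n : Type*} [Fintype m] [Fintype n] (A : Matrix m n ℝ) (i : m) (j : n) :
    |A i j| ≤ frob A := by
  refine Real.abs_le_sqrt ?_
  calc A i j ^ 2 ≤ ∑ j, A i j ^ 2 :=
        Finset.single_le_sum (f := fun j => A i j ^ 2) (fun _ _ => sq_nonneg _) (mem_univ j)
    _ ≤ _ := Finset.single_le_sum (f := fun i => ∑ j, A i j ^ 2)
        (fun _ _ => Finset.sum_nonneg fun _ _ => sq_nonneg _) (mem_univ i)

lemma sum_mul_le_frob_mul_frob {m n : Type*} [Fintype m] [Fintype n] (A B : Matrix m n ℝ) :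
    ∑ i, ∑ j, A i j * B i j ≤ frob A * frob B := by
  simp only [frob, ← Finset.sum_product']
  exact Real.sum_mul_le_sqrt_mul_sqrt _ (fun x : m × n => A x.1 x.2) fun x => B x.1 x.2

lemma le_wMax (w : Fin I → Fin I → ℝ) (k l : Fin I) : w k l ≤ wMax w :=
  le_ciSup (f := fun kl : Fin I × Fin I => w kl.1 kl.2) (Set.finite_range _).bddAbove (k, l)

lemma isCompact_dualBall (w : Fin I → Fin I → ℝ) (J₁ : Finset (Coord p)) :
    IsCompact (dualBall w J₁) := by
  have h1 : IsCompact {A : Mat p | ∀ s t, |A s t| ≤ 1} := by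
    refine isCompact_of_isClosed_of_abs_le ?_ fun H hH => hH
    simp only [Set.ofPred_forall]
    exact isClosed_iInter fun s => isClosed_iInter fun t =>
      isClosed_le (continuous_apply_mat s t).abs continuous_const
  have h2 : IsCompact {A : Mat p | ∀ k l, frob (matBlock A k l) ≤ w k l} := by
    refine isCompact_of_isClosed_of_abs_le (C := wMax w) ?_ fun H hH s t =>
      (abs_apply_le_frob (matBlock H s.1 t.1) s.2 t.2).trans ((hH _ _).trans (le_wMax w _ _))
    simp only [Set.ofPred_forall]
    refine isClosed_iInter fun k => isClosed_iInter fun l => isClosed_le ?_ continuous_const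
    refine Real.continuous_sqrt.comp ?_
    exact continuous_finsetSum _ fun s _ => continuous_finsetSum _ fun t _ =>
      (continuous_apply_mat _ _).pow 2
  have h3 : IsClosed {Z : Mat p × Mat p |
      ∀ s t, s ∉ J₁ ∨ t ∉ J₁ → Z.1 s t = 0 ∧ Z.2 s t = 0} := by
    simp only [Set.ofPred_forall, Set.ofPred_and]
    exact isClosed_iInter fun s => isClosed_iInter fun t => isClosed_iInter fun _ =>
      (isClosed_eq ((continuous_apply_mat s t).comp continuous_fst) continuous_const).inter
        (isClosed_eq ((continuous_apply_mat s t).comp continuous_snd) continuous_const)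
  convert! (h1.prod h2).inter_right h3 using 1
  ext Z
  simp only [dualBall, Set.mem_ofPred_eq, Set.mem_inter_iff, Set.mem_prod]
  tauto

lemma sq_convex_comb_le {a b : ℝ} (ha : 0 ≤ a) (hb : 0 ≤ b) (hab : a + b = 1) (x y : ℝ) :
    (a * x + b * y) ^ 2 ≤ a * x ^ 2 + b * y ^ 2 := by
  have : b = 1 - a := by linarith
  subst this
  nlinarith [mul_nonneg (mul_nonneg ha hb) (sq_nonneg (x - y))]

lemma convex_dualBall {w : Fin I → Fin I → ℝ} (hw : ∀ k l, 0 < w k l) (J₁ : Finset (Coord p)) :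
    Convex ℝ (dualBall w J₁) := by
  rintro Z ⟨hZ1, hZ2, hZ3⟩ Y ⟨hY1, hY2, hY3⟩ a b ha hb hab
  refine ⟨fun s t => ?_, fun k l => ?_, fun s t hst => ?_⟩
  · have h1 := abs_le.1 (hZ1 s t)
    have h2 := abs_le.1 (hY1 s t)
    simp only [Prod.fst_add, Prod.smul_fst, Matrix.add_apply, Matrix.smul_apply, smul_eq_mul]
    rw [abs_le]
    constructor <;> nlinarith
  · have h1 := (frob_le_iff (hw k l).le).1 (hZ2 k l)
    have h2 := (frob_le_iff (hw k l).le).1 (hY2 k l)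
    rw [frob_le_iff (hw k l).le]
    calc ∑ i, ∑ j, matBlock (a • Z + b • Y).2 k l i j ^ 2
        ≤ ∑ i, ∑ j, (a * matBlock Z.2 k l i j ^ 2 + b * matBlock Y.2 k l i j ^ 2) :=
          Finset.sum_le_sum fun i _ => Finset.sum_le_sum fun j _ => by
            simpa [matBlock] using sq_convex_comb_le ha hb hab _ _
      _ = a * (∑ i, ∑ j, matBlock Z.2 k l i j ^ 2) + b * ∑ i, ∑ j, matBlock Y.2 k l i j ^ 2 := by
          simp only [Finset.sum_add_distrib, Finset.mul_sum]
      _ ≤ a * w k l ^ 2 + b * w k l ^ 2 := by gcongr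
      _ = w k l ^ 2 := by rw [← add_mul, hab, one_mul]
  · simp [hZ3 s t hst, hY3 s t hst]

lemma inner2_le_norm11 {A : Mat p} {c : ℝ} (hA : ∀ s t, |A s t| ≤ c) (H : Mat p) :
    inner2 A H ≤ c * norm11 H := by
  rw [inner2_eq_sum, norm11, Finset.mul_sum]
  refine Finset.sum_le_sum fun s _ => ?_
  rw [Finset.mul_sum]
  refine Finset.sum_le_sum fun t _ => ?_
  calc A s t * H s t ≤ |A s t| * |H s t| := by rw [← abs_mul]; exact le_abs_self _
    _ ≤ _ := mul_le_mul_of_nonneg_right (hA s t) (abs_nonneg _)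

lemma sum_sum_coord (f : Coord p → Coord p → ℝ) :
    ∑ s, ∑ t, f s t = ∑ k, ∑ l, ∑ i, ∑ j, f ⟨k, i⟩ ⟨l, j⟩ := by
  simp only [Fintype.sum_sigma]
  exact Finset.sum_congr rfl fun k _ => Finset.sum_comm

lemma inner2_eq_sum_block (A B : Mat p) :
    inner2 A B = ∑ k, ∑ l, ∑ i, ∑ j, matBlock A k l i j * matBlock B k l i j := by
  rw [inner2_eq_sum, sum_sum_coord]; rfl

lemma inner2_le_norm11Star {w : Fin I → Fin I → ℝ} {A : Mat p}
    (hA : ∀ k l, frob (matBlock A k l) ≤ w k l) (H : Mat p) :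
    inner2 A H ≤ norm11Star w H := by
  rw [inner2_eq_sum_block, norm11Star]
  refine Finset.sum_le_sum fun k _ => Finset.sum_le_sum fun l _ => ?_
  exact (sum_mul_le_frob_mul_frob _ _).trans
    (mul_le_mul_of_nonneg_right (hA k l) (frob_nonneg _))

/-- Both penalties of a matrix supported on `J₁ × J₁` are attained by dual variables. -/
lemma exists_mem_dualBall {w : Fin I → Fin I → ℝ} (hw : ∀ k l, 0 < w k l) {J₁ : Finset (Coord p)}
    {H : Mat p} (hH : ∀ s t, s ∉ J₁ ∨ t ∉ J₁ → H s t = 0) :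
    ∃ Z ∈ dualBall w J₁, inner2 Z.1 H = norm11 H ∧ inner2 Z.2 H = norm11Star w H := by
  let Z₁ : Mat p := Matrix.of fun s t => SignType.sign (H s t)
  -- Each block is rescaled to Frobenius norm w_{kl}; on a zero block the quotient by 0 is 0, which
  -- is still admissible.
  let Z₂ : Mat p := Matrix.of fun s t =>
    w s.1 t.1 / frob (matBlock H s.1 t.1) * H s t
  have hblock : ∀ k l i j, matBlock Z₂ k l i j
      = w k l / frob (matBlock H k l) * matBlock H k l i j := fun k l i j => rfl
  have hsq : ∀ k l, ∑ i, ∑ j, matBlock H k l i j ^ 2 = frob (matBlock H k l) ^ 2 := fun k l =>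
    (frob_sq _).symm
  refine ⟨(Z₁, Z₂), ⟨fun s t => ?_, fun k l => ?_, fun s t hst => ?_⟩, ?_, ?_⟩
  · change |((SignType.sign (H s t) : SignType) : ℝ)| ≤ 1
    rcases lt_trichotomy (H s t) 0 with h | h | h <;> simp [h]
  · rw [frob_le_iff (hw k l).le]
    simp only [hblock, mul_pow, ← Finset.mul_sum, hsq]
    rw [← mul_pow]
    refine pow_le_pow_left₀ (mul_nonneg (div_nonneg (hw k l).le (frob_nonneg _)) (frob_nonneg _))
      ?_ 2
    rcases (frob_nonneg (matBlock H k l)).eq_or_lt with h | h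
    · rw [← h]; simpa using (hw k l).le
    · rw [div_mul_cancel₀ _ h.ne']
  · simp [Z₁, Z₂, hH s t hst]
  · rw [inner2_eq_sum, norm11]
    exact Finset.sum_congr rfl fun s _ => Finset.sum_congr rfl fun t _ => sign_mul_self (H s t)
  · rw [inner2_eq_sum_block, norm11Star]
    refine Finset.sum_congr rfl fun k _ => Finset.sum_congr rfl fun l _ => ?_
    simp only [hblock, mul_assoc, ← sq, ← Finset.mul_sum, hsq]
    rcases (frob_nonneg (matBlock H k l)).eq_or_lt with h | h
    · rw [← h]; simp
    · field_simp

/-- The saddle point of the penalized problem restricted to `J₁ × J₁`. -/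
lemma exists_saddle {w : Fin I → Fin I → ℝ} (hw : ∀ k l, 0 < w k l) (J₁ : Finset (Coord p))
    (P S : Mat p) (a c : ℝ) (hne : (restrictedFantope J₁ P).Nonempty) :
    ∃ Z ∈ dualBall w J₁, ∃ H ∈ restrictedFantope J₁ P,
      (∀ K ∈ restrictedFantope J₁ P,
        inner2 (S - a • Z.1 - c • Z.2) K ≤ inner2 (S - a • Z.1 - c • Z.2) H) ∧
      ∀ Y ∈ dualBall w J₁,
        inner2 (S - a • Z.1 - c • Z.2) H ≤ inner2 (S - a • Y.1 - c • Y.2) H := by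
  let f : Mat p × Mat p → Mat p → ℝ := fun Z H => inner2 (S - a • Z.1 - c • Z.2) H
  have hfe : ∀ Z H, f Z H = inner2 S H - a * inner2 Z.1 H - c * inner2 Z.2 H := fun Z H => by
    simp only [f, inner2_sub_left, inner2_smul_left]
  have hneD : (dualBall w J₁).Nonempty := by
    obtain ⟨Z, hZ, -⟩ := exists_mem_dualBall hw (J₁ := J₁) (H := 0) fun _ _ _ => rfl
    exact ⟨Z, hZ⟩
  have hc1 : ∀ H, Continuous fun Z => f Z H := fun H => by
    simp only [hfe, inner2_comm _ H]
    exact (continuous_const.sub (continuous_const.mul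
      ((continuous_inner2_right H).comp continuous_fst))).sub (continuous_const.mul
        ((continuous_inner2_right H).comp continuous_snd))
  obtain ⟨Z, hZ, H, hH, hs⟩ := Sion.exists_isSaddlePointOn (X := dualBall w J₁)
    (Y := restrictedFantope J₁ P) (f := f) hneD (convex_dualBall hw J₁) (isCompact_dualBall w J₁)
    (fun H _ => (hc1 H).lowerSemicontinuous.lowerSemicontinuousOn _)
    (fun H _ => ConvexOn.quasiconvexOn ⟨convex_dualBall hw J₁, fun Z _ Y _ s t _ _ hst => by
      simp only [hfe, Prod.fst_add, Prod.snd_add, Prod.smul_fst, Prod.smul_snd, inner2_add_left,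
        inner2_smul_left, smul_eq_mul]
      refine le_of_eq ?_
      linear_combination (-inner2 S H) * hst⟩)
    (convex_restrictedFantope J₁ P) hne (isCompact_restrictedFantope J₁ P)
    (fun Z _ => (continuous_inner2_right _).upperSemicontinuous.upperSemicontinuousOn _)
    (fun Z _ => ConcaveOn.quasiconcaveOn ⟨convex_restrictedFantope J₁ P,
      fun H _ K _ s t _ _ hst => by
        simp only [f, inner2_add_right, inner2_smul_right, smul_eq_mul]
        exact le_rfl⟩)
  exact ⟨Z, hZ, H, hH, fun K hK => hs Z hZ K hK, fun Y hY => hs Y hY H hH⟩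

/-! ### Passage to Euclidean space -/

open scoped InnerProductSpace

lemma l2norm_eq_norm {m : Type*} [Fintype m] (x : m → ℝ) : l2norm x = ‖WithLp.toLp 2 x‖ := by
  simp [l2norm, EuclideanSpace.norm_eq]

lemma l2norm_sq {m : Type*} [Fintype m] (x : m → ℝ) : l2norm x ^ 2 = x ⬝ᵥ x := by
  rw [l2norm, Real.sq_sqrt (by positivity)]
  simp [dotProduct, sq]

lemma l2norm_eq_one_iff {m : Type*} [Fintype m] (x : m → ℝ) : l2norm x = 1 ↔ x ⬝ᵥ x = 1 := by
  rw [← l2norm_sq]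
  exact (pow_eq_one_iff_of_nonneg (Real.sqrt_nonneg _) two_ne_zero).symm

lemma inner_toLp {m : Type*} [Fintype m] (x y : m → ℝ) :
    ⟪WithLp.toLp 2 x, WithLp.toLp 2 y⟫_ℝ = x ⬝ᵥ y := by
  rw [EuclideanSpace.inner_toLp_toLp, star_trivial, dotProduct_comm]

lemma norm_toLp_sq {m : Type*} [Fintype m] (x : m → ℝ) :
    ‖WithLp.toLp 2 x‖ ^ 2 = x ⬝ᵥ x := by
  rw [← l2norm_eq_norm, l2norm_sq]

lemma l2norm_mulVec_le {m n : Type*} [Fintype m] [Fintype n] (A : Matrix m n ℝ) (x : n → ℝ) :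
    l2norm (A *ᵥ x) ≤ frob A * l2norm x := by
  rw [l2norm, l2norm, frob, ← Real.sqrt_mul (by positivity)]
  refine Real.sqrt_le_sqrt ?_
  rw [Finset.sum_mul]
  exact Finset.sum_le_sum fun i _ => Finset.sum_mul_sq_le_sq_mul_sq _ _ _

lemma abs_dotProduct_le {m : Type*} [Fintype m] (x y : m → ℝ) :
    |x ⬝ᵥ y| ≤ l2norm x * l2norm y := by
  rw [← inner_toLp, l2norm_eq_norm, l2norm_eq_norm]
  exact abs_real_inner_le_norm _ _

lemma abs_dotProduct_mulVec_le {m : Type*} [Fintype m] (A : Matrix m m ℝ) (x y : m → ℝ) :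
    |x ⬝ᵥ A *ᵥ y| ≤ frob A * (l2norm x * l2norm y) := by
  calc |x ⬝ᵥ A *ᵥ y| ≤ l2norm x * l2norm (A *ᵥ y) := abs_dotProduct_le _ _
    _ ≤ l2norm x * (frob A * l2norm y) :=
        mul_le_mul_of_nonneg_left (l2norm_mulVec_le A y) (Real.sqrt_nonneg _)
    _ = _ := by ring

lemma proj_mulVec (u : ℕ → Vec p) (m : ℕ) (x : Vec p) :
    WithLp.toLp 2 (proj u m *ᵥ x)
      = famProj (Icc 1 m) (fun k => WithLp.toLp 2 (u k)) (WithLp.toLp 2 x) := by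
  simp only [proj, famProj_apply, inner_toLp, Matrix.sum_mulVec, vecMulVec_mulVec]
  simp [WithLp.toLp_sum]

lemma specForm_eq (s : Finset ℕ) (γ : ℕ → ℝ) (v : ℕ → Vec p) (x y : Vec p) :
    specForm s γ (fun k => WithLp.toLp 2 (v k)) (WithLp.toLp 2 x) (WithLp.toLp 2 y)
      = x ⬝ᵥ (∑ k ∈ s, γ k • vecMulVec (v k) (v k)) *ᵥ y := by
  rw [← inner2_vecMulVec, inner2_comm, inner2_sum_right]
  refine Finset.sum_congr rfl fun k _ => ?_
  rw [inner2_smul_right, inner2_comm, inner2_vecMulVec, vecMulVec_mulVec, inner_toLp, inner_toLp,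
    dotProduct_smul, dotProduct_comm x]
  simp

/-- A matrix as a bilinear form on Euclidean space. -/
def matForm (A : Mat p) : EuclideanSpace ℝ (Coord p) →ₗ[ℝ] EuclideanSpace ℝ (Coord p) →ₗ[ℝ] ℝ :=
  LinearMap.mk₂ ℝ (fun x y => x.ofLp ⬝ᵥ A *ᵥ y.ofLp)
    (fun x y z => by simp [add_dotProduct]) (fun c x y => by simp)
    (fun x y z => by simp [mulVec_add, dotProduct_add]) (fun c x y => by simp [mulVec_smul])

@[simp] lemma matForm_apply (A : Mat p) (x y : EuclideanSpace ℝ (Coord p)) :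
    matForm A x y = x.ofLp ⬝ᵥ A *ᵥ y.ofLp := rfl

/-! ### Constrained Rayleigh maximizers -/

/-- The vectors supported in `J₁` and orthogonal to `u_1, …, u_m`. -/
def feasible (J₁ : Finset (Coord p)) (u : ℕ → Vec p) (m : ℕ) : Submodule ℝ (Vec p) where
  carrier := {y | (∀ s ∉ J₁, y s = 0) ∧ ∀ k ∈ Icc 1 m, u k ⬝ᵥ y = 0}
  add_mem' := fun {x y} hx hy => ⟨fun s hs => by simp [hx.1 s hs, hy.1 s hs],
    fun k hk => by simp [dotProduct_add, hx.2 k hk, hy.2 k hk]⟩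
  zero_mem' := ⟨fun _ _ => rfl, fun _ _ => dotProduct_zero _⟩
  smul_mem' := fun c x hx => ⟨fun s hs => by simp [hx.1 s hs],
    fun k hk => by simp [dotProduct_smul, hx.2 k hk]⟩

lemma mem_feasible {J₁ : Finset (Coord p)} {u : ℕ → Vec p} {m : ℕ} {y : Vec p} :
    y ∈ feasible J₁ u m ↔ (∀ s ∉ J₁, y s = 0) ∧ ∀ k ∈ Icc 1 m, u k ⬝ᵥ y = 0 := Iff.rfl

/-- A quadratic form attains its maximum over the unit sphere of a subspace; the maximizer
satisfies the first order condition. -/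
lemma exists_rayleigh_max {m : Type*} [Fintype m] (A : Matrix m m ℝ) (V : Submodule ℝ (m → ℝ))
    {z : m → ℝ} (hz : z ∈ V) (hz0 : z ≠ 0) :
    ∃ x ∈ V, x ⬝ᵥ x = 1 ∧ (∀ y ∈ V, y ⬝ᵥ A *ᵥ y ≤ (x ⬝ᵥ A *ᵥ x) * (y ⬝ᵥ y)) ∧
      ∀ y ∈ V, x ⬝ᵥ y = 0 → x ⬝ᵥ A *ᵥ y + y ⬝ᵥ A *ᵥ x = 0 := by
  have hpos : ∀ y : m → ℝ, y ≠ 0 → 0 < y ⬝ᵥ y := fun y hy =>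
    lt_of_le_of_ne (dotProduct_self_star_nonneg y) fun h => hy (dotProduct_self_eq_zero.1 h.symm)
  have hnorm : ∀ y ∈ V, y ≠ 0 → (√(y ⬝ᵥ y))⁻¹ • y ∈ V ∧
      ((√(y ⬝ᵥ y))⁻¹ • y) ⬝ᵥ ((√(y ⬝ᵥ y))⁻¹ • y) = 1 := fun y hy hy0 => by
    refine ⟨V.smul_mem _ hy, ?_⟩
    have h := hpos y hy0
    rw [smul_dotProduct, dotProduct_smul, smul_eq_mul, smul_eq_mul, ← mul_assoc, ← sq, inv_pow,
      Real.sq_sqrt h.le, inv_mul_cancel₀ h.ne']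
  have hK : IsCompact {y : m → ℝ | y ∈ V ∧ y ⬝ᵥ y = 1} := by
    have hB : IsCompact (Set.univ.pi fun _ : m => Set.Icc (-1 : ℝ) 1) :=
      isCompact_univ_pi fun _ => isCompact_Icc
    refine hB.of_isClosed_subset ?_ fun y hy s _ => ?_
    · refine IsClosed.inter V.closed_of_finiteDimensional (isClosed_eq ?_ continuous_const)
      exact continuous_id.dotProduct continuous_id
    · have : y s * y s ≤ y ⬝ᵥ y :=
        Finset.single_le_sum (f := fun s => y s * y s) (fun s _ => mul_self_nonneg _) (mem_univ s)
      rw [hy.2] at this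
      exact ⟨by nlinarith, by nlinarith⟩
  obtain ⟨x, ⟨hxV, hx1⟩, hmax⟩ := hK.exists_isMaxOn ⟨_, hnorm z hz hz0⟩
    (f := fun y => y ⬝ᵥ A *ᵥ y)
    (continuous_id.dotProduct (continuous_const.matrix_mulVec continuous_id)).continuousOn
  have hle : ∀ y ∈ V, y ⬝ᵥ A *ᵥ y ≤ (x ⬝ᵥ A *ᵥ x) * (y ⬝ᵥ y) := fun y hy => by
    rcases eq_or_ne y 0 with rfl | hy0
    · simp
    have h := hpos y hy0
    have h1 : ((√(y ⬝ᵥ y))⁻¹ • y) ⬝ᵥ A *ᵥ ((√(y ⬝ᵥ y))⁻¹ • y) ≤ x ⬝ᵥ A *ᵥ x :=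
      hmax (hnorm y hy hy0)
    rw [mulVec_smul, smul_dotProduct, dotProduct_smul, smul_eq_mul, smul_eq_mul, ← mul_assoc, ← sq,
      inv_pow, Real.sq_sqrt h.le, inv_mul_le_iff₀ h] at h1
    linarith
  refine ⟨x, hxV, hx1, hle, fun y hy hxy => ?_⟩
  set c := x ⬝ᵥ A *ᵥ y + y ⬝ᵥ A *ᵥ x with hc
  set d := (x ⬝ᵥ A *ᵥ x) * (y ⬝ᵥ y) - y ⬝ᵥ A *ᵥ y with hd
  have hd0 : 0 ≤ d := sub_nonneg.2 (hle y hy)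
  -- Perturbing x to x + t y. The matrix need not be symmetric, so the linear coefficient c contains
  -- both cross terms.
  have hquad : ∀ t : ℝ, t * c ≤ t ^ 2 * d := fun t => by
    have h := hle (x + t • y) (V.add_mem hxV (V.smul_mem t hy))
    have hyx : y ⬝ᵥ x = 0 := by rw [dotProduct_comm, hxy]
    simp only [mulVec_add, mulVec_smul, add_dotProduct, dotProduct_add, smul_dotProduct,
      dotProduct_smul, smul_eq_mul, hx1, hxy, hyx] at h
    rw [hc, hd]
    linarith
  by_contra hne
  -- With c ≠ 0 this t violates the quadratic inequality; the 1 keeps the denominator positive when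
  -- d = 0.
  have h1 := hquad (c / (d + 1))
  have hd1 : 0 < d + 1 := by linarith
  have hc2 : 0 < c ^ 2 := by positivity
  rw [div_mul_eq_mul_div, div_pow, div_mul_eq_mul_div, div_le_div_iff₀ hd1 (by positivity)] at h1
  nlinarith

/-! ### Restriction to the support and the resulting norm bounds -/

/-- The restriction of a matrix to `J₁ × J₁`. -/
def restrictMat (J₁ : Finset (Coord p)) (A : Mat p) : Mat p :=
  Matrix.of fun s t => if s ∈ J₁ ∧ t ∈ J₁ then A s t else 0

/-- The restriction of a vector to `J₁`. -/
def restrictVec (J₁ : Finset (Coord p)) (x : Vec p) : Vec p := fun s => if s ∈ J₁ then x s else 0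

lemma restrictVec_dotProduct {J₁ : Finset (Coord p)} {x : Vec p} (hx : ∀ s ∉ J₁, x s = 0)
    (y : Vec p) : x ⬝ᵥ restrictVec J₁ y = x ⬝ᵥ y := by
  refine Finset.sum_congr rfl fun s _ => ?_
  by_cases hs : s ∈ J₁ <;> simp [restrictVec, hs]
  simp [hx s hs]

lemma mulVec_restrictVec {J₁ : Finset (Coord p)} {A : Mat p}
    (hA : ∀ s t, s ∉ J₁ ∨ t ∉ J₁ → A s t = 0) (y : Vec p) :
    A *ᵥ restrictVec J₁ y = A *ᵥ y := by
  funext s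
  exact restrictVec_dotProduct (fun t ht => hA s t (Or.inr ht)) y

lemma inner2_congr {J₁ : Finset (Coord p)} {A B H : Mat p}
    (h : ∀ s ∈ J₁, ∀ t ∈ J₁, A s t = B s t) (hH : ∀ s t, s ∉ J₁ ∨ t ∉ J₁ → H s t = 0) :
    inner2 A H = inner2 B H := by
  rw [inner2_eq_sum, inner2_eq_sum]
  refine Finset.sum_congr rfl fun s _ => Finset.sum_congr rfl fun t _ => ?_
  by_cases hst : s ∈ J₁ ∧ t ∈ J₁
  · rw [h s hst.1 t hst.2]
  · rw [hH s t (by tauto)]; simp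

lemma frob_restrictMat_le {J₁ : Finset (Coord p)} {A : Mat p} {c : ℝ} (hc : 0 ≤ c)
    (hA : ∀ s t, |A s t| ≤ c) : frob (restrictMat J₁ A) ≤ c * J₁.card := by
  rw [frob_le_iff (by positivity)]
  have h1 : ∀ s t, restrictMat J₁ A s t ^ 2
      ≤ if s ∈ J₁ then (if t ∈ J₁ then c ^ 2 else 0) else 0 := by
    intro s t
    by_cases hs : s ∈ J₁ <;> by_cases ht : t ∈ J₁ <;> simp [restrictMat, hs, ht]
    exact sq_le_sq.2 ((hA s t).trans (le_abs_self c))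
  refine (Finset.sum_le_sum fun s _ => Finset.sum_le_sum fun t _ => h1 s t).trans (le_of_eq ?_)
  simp only [Finset.sum_ite_irrel, Finset.sum_const_zero]
  rw [Finset.sum_ite_mem, Finset.sum_ite_mem]
  simp
  ring

/-- The views met by the coordinates in `J₁` all belong to `J₂`. -/
def Covers (J₂ : Finset (Fin I)) (J₁ : Finset (Coord p)) : Prop := ∀ s ∈ J₁, s.1 ∈ J₂

lemma l2norm_vecBlock_eq_zero_iff (x : Vec p) (k : Fin I) :
    l2norm (vecBlock x k) = 0 ↔ ∀ i, x ⟨k, i⟩ = 0 := by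
  rw [← pow_eq_zero_iff two_ne_zero, l2norm_sq, dotProduct_self_eq_zero, funext_iff]
  rfl

lemma covers_blockUnion (v : ℕ → Vec p) (m : ℕ) : Covers (blockUnion v m) (elemUnion v m) := by
  rintro ⟨k, i⟩ hs
  simp only [elemUnion, Finset.mem_biUnion, elemSupp, Finset.mem_filter, mem_univ, true_and] at hs
  obtain ⟨j, hj, hne⟩ := hs
  simp only [blockUnion, Finset.mem_biUnion, blockSupp, Finset.mem_filter, mem_univ, true_and]
  exact ⟨j, hj, fun h => hne ((l2norm_vecBlock_eq_zero_iff _ _).1 h i)⟩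

lemma blockSupp_subset {J₂ : Finset (Fin I)} {J₁ : Finset (Coord p)} (h : Covers J₂ J₁) {x : Vec p}
    (hx : ∀ s ∉ J₁, x s = 0) : blockSupp x ⊆ J₂ := by
  intro k hk
  simp only [blockSupp, Finset.mem_filter, mem_univ, true_and] at hk
  rw [ne_eq, l2norm_vecBlock_eq_zero_iff] at hk
  push Not at hk
  obtain ⟨i, hi⟩ := hk
  exact h ⟨k, i⟩ (by_contra fun hn => hi (hx _ hn))

lemma elemSupp_subset_iff {J₁ : Finset (Coord p)} {x : Vec p} :
    elemSupp x ⊆ J₁ ↔ ∀ s ∉ J₁, x s = 0 := by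
  simp only [elemSupp, Finset.subset_iff, Finset.mem_filter, mem_univ, true_and]
  exact forall_congr' fun s => by rw [not_imp_comm]

/-- At most |J₂|² blocks are nonzero, each of Frobenius norm at most the largest weight. -/
lemma frob_dual_le {w : Fin I → Fin I → ℝ} {J₁ : Finset (Coord p)} {J₂ : Finset (Fin I)}
    (hJ : Covers J₂ J₁) (hwM : 0 ≤ wMax w) {A : Mat p}
    (hA : ∀ k l, frob (matBlock A k l) ≤ w k l)
    (hA0 : ∀ s t, s ∉ J₁ ∨ t ∉ J₁ → A s t = 0) : frob A ≤ J₂.card * wMax w := by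
  rw [frob_le_iff (by positivity), sum_sum_coord fun s t => A s t ^ 2]
  have h1 : ∀ k l, ∑ i, ∑ j, A ⟨k, i⟩ ⟨l, j⟩ ^ 2
      ≤ if k ∈ J₂ then (if l ∈ J₂ then wMax w ^ 2 else 0) else 0 := by
    intro k l
    by_cases hkl : k ∈ J₂ ∧ l ∈ J₂
    · rw [if_pos hkl.1, if_pos hkl.2]
      exact (frob_le_iff (A := matBlock A k l) hwM).1 ((hA k l).trans (le_wMax w k l))
    · have : ∑ i, ∑ j, A ⟨k, i⟩ ⟨l, j⟩ ^ 2 = 0 :=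
        Finset.sum_eq_zero fun i _ => Finset.sum_eq_zero fun j _ => by
          rw [hA0 ⟨k, i⟩ ⟨l, j⟩]
          · ring
          · by_contra hcon
            push Not at hcon
            exact hkl ⟨hJ _ hcon.1, hJ _ hcon.2⟩
      rw [this]
      split_ifs <;> positivity
  refine (Finset.sum_le_sum fun s _ => Finset.sum_le_sum fun t _ => h1 s t).trans (le_of_eq ?_)
  simp only [Finset.sum_ite_irrel, Finset.sum_const_zero]
  rw [Finset.sum_ite_mem, Finset.sum_ite_mem]
  simp
  ring

lemma abs_apply_le_normInf (A : Mat p) (s t : Coord p) : |A s t| ≤ normInf A :=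
  le_ciSup (f := fun st : Coord p × Coord p => |A st.1 st.2|) (Set.finite_range _).bddAbove (s, t)

lemma offElem_nonneg (J₁ : Finset (Coord p)) (A : Mat p) : 0 ≤ offElem J₁ A :=
  Real.iSup_nonneg fun _ => Real.sqrt_nonneg _

lemma abs_mulVec_le_offElem {J₁ : Finset (Coord p)} {A : Mat p} (hA : A.IsSymm) {x : Vec p}
    (hx : ∀ s ∉ J₁, x s = 0) {s : Coord p} (hs : s ∉ J₁) :
    |(A *ᵥ x) s| ≤ offElem J₁ A * l2norm x := by
  have h1 : (A *ᵥ x) s = ∑ t ∈ J₁, A t s * x t := by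
    rw [mulVec, dotProduct, ← Finset.sum_subset (Finset.subset_univ J₁)]
    · exact Finset.sum_congr rfl fun t _ => by rw [hA.apply]
    · intro t _ ht
      rw [hx t ht, mul_zero]
  have h2 : √(∑ t ∈ J₁, A t s ^ 2) ≤ offElem J₁ A :=
    le_ciSup (f := fun t : {t : Coord p // t ∉ J₁} => √(∑ s ∈ J₁, A s t ^ 2))
      (Set.finite_range _).bddAbove ⟨s, hs⟩
  have h3 : √(∑ t ∈ J₁, x t ^ 2) ≤ l2norm x :=
    Real.sqrt_le_sqrt (Finset.sum_le_univ_sum_of_nonneg fun _ => sq_nonneg _)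
  have h4 : |∑ t ∈ J₁, A t s * x t| ≤ √(∑ t ∈ J₁, A t s ^ 2) * √(∑ t ∈ J₁, x t ^ 2) := by
    rw [← Real.sqrt_mul (by positivity)]
    exact Real.abs_le_sqrt (Finset.sum_mul_sq_le_sq_mul_sq _ _ _)
  rw [h1]
  exact h4.trans (mul_le_mul h2 h3 (Real.sqrt_nonneg _) (offElem_nonneg _ _))

/-! ### The certificate -/

/-- The matrix whose quadratic form, by strong concavity of the linearized problem, certifies that
`x xᵀ` solves the penalized problem: `A - q xᵀ - x qᵀ - W`, where `q` is the part of `A x`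
outside `J₁`. -/
def certificate (J₁ : Finset (Coord p)) (A W : Mat p) (x : Vec p) : Mat p :=
  A - (vecMulVec (A *ᵥ x - restrictVec J₁ (A *ᵥ x)) x
    + vecMulVec x (A *ᵥ x - restrictVec J₁ (A *ᵥ x))) - W

lemma dotProduct_certificate (J₁ : Finset (Coord p)) (A W : Mat p) (x y z : Vec p) :
    y ⬝ᵥ certificate J₁ A W x *ᵥ z = y ⬝ᵥ A *ᵥ z
      - ((y ⬝ᵥ (A *ᵥ x - restrictVec J₁ (A *ᵥ x))) * (x ⬝ᵥ z)
        + (y ⬝ᵥ x) * ((A *ᵥ x - restrictVec J₁ (A *ᵥ x)) ⬝ᵥ z)) - y ⬝ᵥ W *ᵥ z := by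
  simp only [certificate, sub_mulVec, add_mulVec, dotProduct_sub, dotProduct_add, vecMulVec_mulVec,
    dotProduct_smul, MulOpposite.smul_eq_mul_unop, MulOpposite.unop_op]

lemma dotProduct_mulVec_comm {m : Type*} [Fintype m] {A : Matrix m m ℝ} (hA : A.IsSymm)
    (x y : m → ℝ) : x ⬝ᵥ A *ᵥ y = y ⬝ᵥ A *ᵥ x := by
  rw [dotProduct_mulVec, ← mulVec_transpose, hA.eq, dotProduct_comm]

lemma dotProduct_residual {J₁ : Finset (Coord p)} {x : Vec p} (hx : ∀ s ∉ J₁, x s = 0)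
    (z : Vec p) : x ⬝ᵥ (z - restrictVec J₁ z) = 0 := by
  rw [dotProduct_sub, restrictVec_dotProduct hx, sub_self]

/-- The quadratic form of the certificate has a spectral gap at `x` on the orthogonal complement of
`u_1, …, u_m`. -/
lemma certificate_le {J₁ : Finset (Coord p)} {A W : Mat p} (hA : A.IsSymm)
    (hW : ∀ s t, s ∉ J₁ ∨ t ∉ J₁ → W s t = 0) {u : ℕ → Vec p} {m : ℕ}
    (hu : ∀ k ∈ Icc 1 m, ∀ s ∉ J₁, u k s = 0) {x : Vec p} (hx : x ∈ feasible J₁ u m)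
    (hx1 : x ⬝ᵥ x = 1) {μ ν K : ℝ} (hμ : x ⬝ᵥ A *ᵥ x - x ⬝ᵥ W *ᵥ x = μ)
    (hfirst : ∀ y ∈ feasible J₁ u m, x ⬝ᵥ y = 0 →
      x ⬝ᵥ (A - W) *ᵥ y + y ⬝ᵥ (A - W) *ᵥ x = 0)
    (hWK : ∀ y : Vec p, |y ⬝ᵥ W *ᵥ y| ≤ K * (y ⬝ᵥ y))
    (hAν : ∀ y : Vec p, (∀ k ∈ Icc 1 m, u k ⬝ᵥ y = 0) → x ⬝ᵥ y = 0 →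
      y ⬝ᵥ A *ᵥ y ≤ ν * (y ⬝ᵥ y))
    {y : Vec p} (hy : ∀ k ∈ Icc 1 m, u k ⬝ᵥ y = 0) :
    y ⬝ᵥ certificate J₁ A W x *ᵥ y
      ≤ μ * (y ⬝ᵥ y) - (μ - ν - K) * (y ⬝ᵥ y - (x ⬝ᵥ y) ^ 2) := by
  set M := certificate J₁ A W x with hM
  obtain ⟨hxJ, hxu⟩ := mem_feasible.1 hx
  set α := x ⬝ᵥ y with hα
  set z := y - α • x with hz
  set q := A *ᵥ x - restrictVec J₁ (A *ᵥ x) with hq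
  have hyz : y = α • x + z := by rw [hz]; abel
  have hxz : x ⬝ᵥ z = 0 := by
    rw [hz, dotProduct_sub, dotProduct_smul, hx1, ← hα]; simp
  have hzx : z ⬝ᵥ x = 0 := by rw [dotProduct_comm, hxz]
  have hzz : z ⬝ᵥ z = y ⬝ᵥ y - α ^ 2 := dotProduct_self_sub_sq hx1 y
  have hzu : ∀ k ∈ Icc 1 m, u k ⬝ᵥ z = 0 := fun k hk => by
    rw [hz, dotProduct_sub, dotProduct_smul, hy k hk, hxu k hk]; simp
  have hxq : x ⬝ᵥ q = 0 := dotProduct_residual hxJ _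
  have hqx : q ⬝ᵥ x = 0 := by rw [dotProduct_comm, hxq]
  have hxx : x ⬝ᵥ M *ᵥ x = μ := by
    rw [hM, dotProduct_certificate, ← hq, hxq, hqx, ← hμ]; ring
  have hzMz : z ⬝ᵥ M *ᵥ z ≤ (ν + K) * (z ⬝ᵥ z) := by
    have h1 := hAν z hzu hxz
    have h2 := (abs_le.1 (hWK z)).1
    rw [hM, dotProduct_certificate, ← hq, hxz, hzx]
    linarith
  -- Restricting z to J₁ keeps it feasible, because x and the u_k live on J₁, so the first order
  -- condition applies to z'. What is left of the cross terms is 2 z·q, exactly what the rank two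
  -- correction in M removes.
  have hcross : x ⬝ᵥ M *ᵥ z + z ⬝ᵥ M *ᵥ x = 0 := by
    set z' := restrictVec J₁ z with hz'
    have hz'J : ∀ s ∉ J₁, z' s = 0 := fun s hs => by simp [hz', restrictVec, hs]
    have hxz' : x ⬝ᵥ z' = 0 := by rw [hz', restrictVec_dotProduct hxJ, hxz]
    have hz'V : z' ∈ feasible J₁ u m := mem_feasible.2 ⟨hz'J, fun k hk => by
      rw [hz', restrictVec_dotProduct (hu k hk), hzu k hk]⟩
    have h1 := hfirst z' hz'V hxz'
    have h2 : W *ᵥ z' = W *ᵥ z := mulVec_restrictVec hW z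
    have h3 : z' ⬝ᵥ W *ᵥ x = z ⬝ᵥ W *ᵥ x := by
      have hWx : ∀ s ∉ J₁, (W *ᵥ x) s = 0 := fun s hs =>
        Finset.sum_eq_zero fun t _ => by
          change W s t * x t = 0
          rw [hW s t (Or.inl hs), zero_mul]
      rw [dotProduct_comm, hz', restrictVec_dotProduct hWx, dotProduct_comm]
    have h4 : z ⬝ᵥ A *ᵥ x = z' ⬝ᵥ A *ᵥ x + z ⬝ᵥ q := by
      have h5 : z' ⬝ᵥ q = 0 := dotProduct_residual hz'J _
      have h6 : z ⬝ᵥ restrictVec J₁ (A *ᵥ x) = z' ⬝ᵥ A *ᵥ x := by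
        refine Finset.sum_congr rfl fun s _ => ?_
        simp only [hz', restrictVec]
        split_ifs <;> simp
      rw [hq, dotProduct_sub, h6]; ring
    rw [sub_mulVec, sub_mulVec, dotProduct_sub, dotProduct_sub, h2, h3,
      dotProduct_mulVec_comm hA x z'] at h1
    rw [hM, dotProduct_certificate, dotProduct_certificate, ← hq, hxq, hqx, hxz, hzx, hx1,
      dotProduct_mulVec_comm hA x z, dotProduct_comm q z]
    linarith
  have hexp : y ⬝ᵥ M *ᵥ y = α ^ 2 * (x ⬝ᵥ M *ᵥ x) + α * (x ⬝ᵥ M *ᵥ z + z ⬝ᵥ M *ᵥ x)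
      + z ⬝ᵥ M *ᵥ z := by
    rw [hyz]
    simp only [mulVec_add, mulVec_smul, add_dotProduct, dotProduct_add, smul_dotProduct,
      dotProduct_smul, smul_eq_mul]
    ring
  rw [hexp, hxx, hcross, ← hzz]
  rw [hzz] at hzMz ⊢
  linarith

lemma certificate_apply_of_mem {J₁ : Finset (Coord p)} {A W : Mat p} {x : Vec p} {s t : Coord p}
    (hs : s ∈ J₁) (ht : t ∈ J₁) : certificate J₁ A W x s t = A s t - W s t := by
  simp [certificate, vecMulVec_apply, restrictVec, hs, ht]

/-- Outside `J₁ × J₁`, the certificate differs from `A` by at most the size of `A x` outside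
`J₁`. -/
lemma abs_certificate_sub_le {J₁ : Finset (Coord p)} {A W : Mat p}
    (hW : ∀ s t, s ∉ J₁ ∨ t ∉ J₁ → W s t = 0) {x : Vec p} (hxJ : ∀ s ∉ J₁, x s = 0)
    (hx1 : x ⬝ᵥ x = 1) {d : ℝ} (hd : 0 ≤ d) (hAx : ∀ s ∉ J₁, |(A *ᵥ x) s| ≤ d) {s t : Coord p}
    (hst : s ∉ J₁ ∨ t ∉ J₁) : |A s t - certificate J₁ A W x s t| ≤ d := by
  have hx : ∀ s, |x s| ≤ 1 := fun s => by
    have : x s * x s ≤ x ⬝ᵥ x :=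
      Finset.single_le_sum (f := fun s => x s * x s) (fun s _ => mul_self_nonneg _) (mem_univ s)
    rw [hx1] at this
    rw [abs_le]
    constructor <;> nlinarith
  have hmul : ∀ s ∉ J₁, ∀ t, |(A *ᵥ x) s * x t| ≤ d := fun s hs t => by
    rw [abs_mul]
    calc _ ≤ d * 1 := mul_le_mul (hAx s hs) (hx t) (abs_nonneg _) hd
      _ = d := mul_one d
  by_cases hs : s ∈ J₁
  · have ht : t ∉ J₁ := by tauto
    have := hmul t ht s
    simpa [certificate, vecMulVec_apply, restrictVec, hs, ht, hW s t hst, hxJ t ht, mul_comm]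
      using this
  · by_cases ht : t ∈ J₁
    · have := hmul s hs t
      simpa [certificate, vecMulVec_apply, restrictVec, hs, ht, hW s t hst, hxJ s hs] using this
    · simpa [certificate, vecMulVec_apply, restrictVec, hs, ht, hW s t hst, hxJ s hs, hxJ t ht]
        using hd

/-! ### The signal matrix and the constants b_j -/

lemma isSymm_sum_vecMulVec (s : Finset ℕ) (γ : ℕ → ℝ) (v : ℕ → Vec p) :
    (∑ k ∈ s, γ k • vecMulVec (v k) (v k)).IsSymm := by
  ext i j
  simp only [transpose_apply, Matrix.sum_apply, Matrix.smul_apply, vecMulVec_apply, smul_eq_mul]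
  exact Finset.sum_congr rfl fun _ _ => by ring

lemma sum_vecMulVec_mulVec {s : Finset ℕ} {γ : ℕ → ℝ} {v : ℕ → Vec p}
    (hv : ∀ j ∈ s, ∀ k ∈ s, v j ⬝ᵥ v k = if j = k then (1 : ℝ) else 0) {j : ℕ} (hj : j ∈ s) :
    (∑ k ∈ s, γ k • vecMulVec (v k) (v k)) *ᵥ v j = γ j • v j := by
  rw [Matrix.sum_mulVec, Finset.sum_eq_single j]
  · rw [smul_mulVec, vecMulVec_mulVec, hv j hj j hj]; simp
  · intro k hk hkj
    rw [smul_mulVec, vecMulVec_mulVec, hv k hk j hj, if_neg hkj]; simp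
  · exact fun h => absurd hj h

lemma eps_nonneg (v vhat : ℕ → Vec p) (m : ℕ) : 0 ≤ eps v vhat m := by
  rw [eps]
  split_ifs
  · exact le_rfl
  · exact (frob_nonneg _).trans (le_max_left _ _)

lemma frob_proj_sub_le_eps (v vhat : ℕ → Vec p) (m : ℕ) :
    frob (proj v m - proj vhat m) ≤ eps v vhat m := by
  rw [eps]
  split_ifs with h
  · simp [h, proj, frob]
  · exact le_max_left _ _

lemma deflation {r j : ℕ} {γ : ℕ → ℝ} {v vhat : ℕ → Vec p}
    (hv : ∀ j ∈ Icc 1 r, ∀ k ∈ Icc 1 r, v j ⬝ᵥ v k = if j = k then (1 : ℝ) else 0)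
    (hpos : ∀ j ∈ Icc 1 r, 0 < γ j) (hanti : StrictAntiOn γ (Set.Icc 1 r)) (hj : j ∈ Icc 1 r)
    (hu : ∀ a ∈ Icc 1 (j - 1), ∀ b ∈ Icc 1 (j - 1),
      vhat a ⬝ᵥ vhat b = if a = b then (1 : ℝ) else 0) :
    Deflation r j γ (if j < r then γ (j + 1) else 0) (eps v vhat (j - 1))
      (fun k => WithLp.toLp 2 (v k)) (fun k => WithLp.toLp 2 (vhat k)) := by
  have hle : ∀ a b, 1 ≤ a → a ≤ b → b ≤ r → γ b ≤ γ a := fun a b ha hab hb =>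
    hanti.antitoneOn ⟨ha, hab.trans hb⟩ ⟨ha.trans hab, hb⟩ hab
  have hj' := Finset.mem_Icc.1 hj
  refine ⟨hj'.1, hj'.2, fun a ha b hb => ?_, fun a ha b hb => ?_, hpos, fun k hk => ?_,
    fun k hk => ?_, fun k hk => ?_, ?_, eps_nonneg _ _ _, fun x => ?_⟩
  · rw [inner_toLp, hv a ha b hb]
  · rw [inner_toLp, hu a ha b hb]
  · rw [Finset.mem_Icc] at hk; exact hle 1 k le_rfl hk.1 hk.2
  · rw [Finset.mem_Icc] at hk; exact hle j k hj'.1 hk.1 hk.2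
  · rw [Finset.mem_Icc] at hk
    rw [if_pos (by omega)]
    exact hle (j + 1) k (by omega) hk.1 hk.2
  · split_ifs with h
    · exact (hpos _ (Finset.mem_Icc.2 ⟨by omega, by omega⟩)).le
    · exact le_rfl
  · have h1 := l2norm_mulVec_le (proj v (j - 1) - proj vhat (j - 1)) x.ofLp
    rw [sub_mulVec, l2norm_eq_norm, l2norm_eq_norm, WithLp.toLp_sub, proj_mulVec, proj_mulVec] at h1
    exact h1.trans (mul_le_mul_of_nonneg_right (frob_proj_sub_le_eps _ _ _) (norm_nonneg _))

lemma gap_pos {r j : ℕ} {γ : ℕ → ℝ} (hpos : ∀ j ∈ Icc 1 r, 0 < γ j)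
    (hanti : StrictAntiOn γ (Set.Icc 1 r)) (hj : j ∈ Icc 1 r) : 0 < gap r γ j := by
  have hj' := Finset.mem_Icc.1 hj
  rw [gap]
  split_ifs with h
  · exact sub_pos.2 (hanti ⟨hj'.1, hj'.2⟩ ⟨by omega, by omega⟩ (Nat.lt_succ_self j))
  · rw [sub_zero]; exact hpos j hj

lemma wMax_nonneg {w : Fin I → Fin I → ℝ} (hw : ∀ k l, 0 < w k l) : 0 ≤ wMax w :=
  Real.iSup_nonneg fun _ => (hw _ _).le

/-- All summands of b_j are nonnegative, so b_j dominates the last one, the Davis-Kahan radius of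
step j. -/
lemma term_le_bSeq {r j : ℕ} {γ : ℕ → ℝ} (v vhat : ℕ → Vec p) {w : Fin I → Fin I → ℝ}
    {lam β : ℝ} (J₁ : Finset (Coord p)) (J₂ : Finset (Fin I))
    (hpos : ∀ j ∈ Icc 1 r, 0 < γ j) (hanti : StrictAntiOn γ (Set.Icc 1 r)) (hj : j ∈ Icc 1 r)
    (hw : ∀ k l, 0 < w k l) (hlam : 0 ≤ lam) (hβ : 0 ≤ β) (hβ1 : β ≤ 1) :
    4 * (2 * (lam * β * (J₁.card : ℝ) + lam * (1 - β) * (J₂.card : ℝ) * wMax w)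
      + 2 * γ j * eps v vhat (j - 1) + γ 1 * eps v vhat (j - 1) ^ 2)
      ≤ bSeq r γ v vhat w lam β J₁ J₂ j * gap r γ j := by
  have hj' := Finset.mem_Icc.1 hj
  have hw1 := wMax_nonneg hw
  have hβ' : 0 ≤ 1 - β := sub_nonneg.2 hβ1
  rw [← div_le_iff₀ (gap_pos hpos hanti hj), bSeq]
  refine Finset.single_le_sum (f := fun k =>
    4 * (2 * (lam * β * (J₁.card : ℝ) + lam * (1 - β) * (J₂.card : ℝ) * wMax w)
      + 2 * γ k * eps v vhat (k - 1) + γ 1 * eps v vhat (k - 1) ^ 2) / gap r γ k)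
    (fun k hk => ?_) (Finset.mem_Icc.2 ⟨hj'.1, le_rfl⟩)
  rw [Finset.mem_Icc] at hk
  have hk' : k ∈ Icc 1 r := Finset.mem_Icc.2 ⟨hk.1, hk.2.trans hj'.2⟩
  have h1 := (hpos k hk').le
  have h2 := (hpos 1 (Finset.mem_Icc.2 ⟨le_rfl, by omega⟩)).le
  have h3 := gap_pos hpos hanti hk'
  have h4 := eps_nonneg v vhat (k - 1)
  positivity

/-- Weak duality: S - M splits into an elementwise and a blockwise dual variable, each paid for by
its penalty. -/
lemma objective_le_inner2 {S M Z : Mat p} {w : Fin I → Fin I → ℝ} {lam β : ℝ} (hlam : 0 ≤ lam)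
    (hβ1 : β ≤ 1) (hZ : ∀ k l, frob (matBlock Z k l) ≤ w k l)
    (hM : ∀ s t, |(S - M - (lam * (1 - β)) • Z) s t| ≤ lam * β) (H : Mat p) :
    objective S w lam β H ≤ inner2 M H := by
  have h1 := inner2_le_norm11 hM H
  have h2 := mul_le_mul_of_nonneg_left (inner2_le_norm11Star hZ H)
    (mul_nonneg hlam (sub_nonneg.2 hβ1))
  rw [inner2_sub_left, inner2_sub_left, inner2_smul_left] at h1
  rw [objective]
  linarith

/-! ### The dual residual and the size of the constants -/

/-- The residual on `J₁ × J₁` of the dual variables against the noise `N`. -/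
def dualResidual (J₁ : Finset (Coord p)) (a c : ℝ) (N : Mat p) (Z : Mat p × Mat p) : Mat p :=
  restrictMat J₁ (a • Z.1 - N) + c • Z.2

lemma dualResidual_apply_of_mem {J₁ : Finset (Coord p)} {a c : ℝ} {N : Mat p} {Z : Mat p × Mat p}
    {s t : Coord p} (hs : s ∈ J₁) (ht : t ∈ J₁) :
    dualResidual J₁ a c N Z s t = a * Z.1 s t - N s t + c * Z.2 s t := by
  simp [dualResidual, restrictMat, hs, ht]

lemma dualResidual_apply_of_notMem {w : Fin I → Fin I → ℝ} {J₁ : Finset (Coord p)} {a c : ℝ}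
    {N : Mat p} {Z : Mat p × Mat p} (hZ : Z ∈ dualBall w J₁) {s t : Coord p}
    (hst : s ∉ J₁ ∨ t ∉ J₁) : dualResidual J₁ a c N Z s t = 0 := by
  have h : ¬(s ∈ J₁ ∧ t ∈ J₁) := by tauto
  simp [dualResidual, restrictMat, h, (hZ.2.2 s t hst).2]

/-- The entries of a Z₁ - N are at most 2a, which gives 2 a s₁; the blockwise part gives c s₂ w₁,
and its factor 2 is slack. -/
lemma abs_dotProduct_dualResidual_le {w : Fin I → Fin I → ℝ} (hw : ∀ k l, 0 < w k l)
    {J₁ : Finset (Coord p)} {J₂ : Finset (Fin I)} (hJ : Covers J₂ J₁) {a c : ℝ} (ha : 0 ≤ a)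
    (hc : 0 ≤ c) {N : Mat p} (hN : ∀ s t, |N s t| ≤ a) {Z : Mat p × Mat p} (hZ : Z ∈ dualBall w J₁)
    (x y : Vec p) :
    |x ⬝ᵥ dualResidual J₁ a c N Z *ᵥ y|
      ≤ 2 * (a * (J₁.card : ℝ) + c * (J₂.card : ℝ) * wMax w) * (l2norm x * l2norm y) := by
  have hwM := wMax_nonneg hw
  have h1 : ∀ s t, |(a • Z.1 - N) s t| ≤ 2 * a := fun s t => by
    have hz : |a * Z.1 s t| ≤ a := by
      rw [abs_mul, abs_of_nonneg ha]
      exact mul_le_of_le_one_right ha (hZ.1 s t)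
    rw [Matrix.sub_apply, Matrix.smul_apply, smul_eq_mul]
    exact (abs_sub _ _).trans (by linarith [hN s t])
  have hn : 0 ≤ l2norm x * l2norm y := mul_nonneg (Real.sqrt_nonneg _) (Real.sqrt_nonneg _)
  have h2 := (abs_dotProduct_mulVec_le (restrictMat J₁ (a • Z.1 - N)) x y).trans
    (mul_le_mul_of_nonneg_right (frob_restrictMat_le (by positivity) h1) hn)
  have h3 := (abs_dotProduct_mulVec_le Z.2 x y).trans
    (mul_le_mul_of_nonneg_right (frob_dual_le hJ hwM hZ.2.1 fun s t hst => (hZ.2.2 s t hst).2) hn)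
  have h4 : |c * (x ⬝ᵥ Z.2 *ᵥ y)| ≤ c * (J₂.card * wMax w * (l2norm x * l2norm y)) := by
    rw [abs_mul, abs_of_nonneg hc]
    exact mul_le_mul_of_nonneg_left h3 hc
  have h5 : 0 ≤ c * (J₂.card * wMax w * (l2norm x * l2norm y)) := by positivity
  rw [dualResidual, add_mulVec, dotProduct_add, smul_mulVec, dotProduct_smul, smul_eq_mul]
  refine (abs_add_le _ _).trans ?_
  linarith

lemma Deflation.bounds {E : Type*} [NormedAddCommGroup E] [InnerProductSpace ℝ E] {r j : ℕ}
    {γ : ℕ → ℝ} {γ' ε : ℝ} {v u : ℕ → E} (h : Deflation r j γ γ' ε v u) {K b : ℝ} (hK : 0 ≤ K)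
    (hgap : 0 < γ j - γ')
    (hKb : 4 * (K + 2 * γ j * ε + γ 1 * ε ^ 2) ≤ b * (γ j - γ'))
    (hsep : 2 * K + 4 * (γ 1 * b) < γ j - γ') :
    0 ≤ b ∧ ε ≤ b ∧ b < 1 / 4 := by
  have hγj := h.pos j h.mem
  have hγ1j := h.le_first j h.mem
  have hγ1 : 0 < γ 1 := hγj.trans_le hγ1j
  have hlast := h.last_nonneg
  have hε := h.eps_nonneg
  have hsq : 0 ≤ γ 1 * ε ^ 2 := by positivity
  have hlin : 0 ≤ γ j * ε := by positivity
  have hb0 : 0 ≤ b := nonneg_of_mul_nonneg_left (le_trans (by linarith) hKb) hgap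
  refine ⟨hb0, ?_, ?_⟩
  · have h1 : b * (γ j - γ') ≤ b * γ j := mul_le_mul_of_nonneg_left (by linarith) hb0
    refine le_of_mul_le_mul_left ?_ hγj
    linarith
  · refine lt_of_mul_lt_mul_left ?_ hγ1.le
    linarith

/-- The witness is v_j minus its projection on the earlier estimates; the projection has norm at
most ε < 1 = ‖v_j‖. -/
lemma exists_mem_feasible_ne_zero {r j : ℕ} {γ : ℕ → ℝ} {γ' ε : ℝ} {v vhat : ℕ → Vec p}
    (hD : Deflation r j γ γ' ε (fun k => WithLp.toLp 2 (v k)) (fun k => WithLp.toLp 2 (vhat k)))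
    {J₁ : Finset (Coord p)} (hvJ : ∀ s ∉ J₁, v j s = 0)
    (huJ : ∀ k ∈ Icc 1 (j - 1), ∀ s ∉ J₁, vhat k s = 0) (hε : ε < 1) :
    ∃ z ∈ feasible J₁ vhat (j - 1), z ≠ 0 := by
  refine ⟨v j - proj vhat (j - 1) *ᵥ v j, mem_feasible.2 ⟨fun s hs => ?_, fun k hk => ?_⟩,
    fun h0 => ?_⟩
  · have h0 : (proj vhat (j - 1) *ᵥ v j) s = 0 := by
      simp only [proj, Matrix.sum_mulVec, vecMulVec_mulVec, Finset.sum_apply]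
      exact Finset.sum_eq_zero fun k hk => by simp [huJ k hk s hs]
    rw [Pi.sub_apply, hvJ s hs, h0, sub_zero]
  · have := hD.inner_residual (WithLp.toLp 2 (v j)) k hk
    rwa [← proj_mulVec, ← WithLp.toLp_sub, inner_toLp] at this
  · have h1 := hD.norm_famProj_v_le
    rw [← proj_mulVec, ← sub_eq_zero.1 h0, hD.norm_v] at h1
    linarith

/-! ### Existence and uniqueness of the solution -/

/-- The leading vector of `∑ γ_k v_k v_kᵀ - W` among the vectors supported in `J₁` and orthogonal
to the previous estimates is close to `v_j`, and its certificate has a spectral gap. -/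
lemma exists_leading_vector {r j : ℕ} {γ : ℕ → ℝ} {γ' ε : ℝ} {v vhat : ℕ → Vec p}
    (hD : Deflation r j γ γ' ε (fun k => WithLp.toLp 2 (v k)) (fun k => WithLp.toLp 2 (vhat k)))
    {A : Mat p} (hA : A = ∑ j ∈ Icc 1 r, γ j • vecMulVec (v j) (v j))
    {J₁ : Finset (Coord p)} (hvJ : ∀ s ∉ J₁, v j s = 0)
    (huJ : ∀ k ∈ Icc 1 (j - 1), ∀ s ∉ J₁, vhat k s = 0) {W : Mat p}
    (hWJ : ∀ s t, s ∉ J₁ ∨ t ∉ J₁ → W s t = 0) {K b : ℝ} (hK : 0 ≤ K)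
    (hWK : ∀ x y : Vec p, |x ⬝ᵥ W *ᵥ y| ≤ K * (l2norm x * l2norm y)) (hgap : 0 < γ j - γ')
    (hKb : 4 * (K + 2 * γ j * ε + γ 1 * ε ^ 2) ≤ b * (γ j - γ'))
    (hsep : 2 * K + 4 * (γ 1 * b) < γ j - γ') :
    ∃ (x : Vec p) (σ g : ℝ), x ⬝ᵥ x = 1 ∧ x ∈ feasible J₁ vhat (j - 1) ∧
      l2norm (x - σ • v j) ≤ b ∧ 0 < g ∧ ∀ y, (∀ k ∈ Icc 1 (j - 1), vhat k ⬝ᵥ y = 0) →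
        y ⬝ᵥ certificate J₁ A W x *ᵥ y
          ≤ (x ⬝ᵥ A *ᵥ x - x ⬝ᵥ W *ᵥ x) * (y ⬝ᵥ y) - g * (y ⬝ᵥ y - (x ⬝ᵥ y) ^ 2) := by
  obtain ⟨hb0, hεb, hb4⟩ := hD.bounds hK hgap hKb hsep
  obtain ⟨z, hzV, hz0⟩ := exists_mem_feasible_ne_zero hD hvJ huJ (by linarith)
  obtain ⟨x, hxV, hx1, hxmax, hfirst⟩ := exists_rayleigh_max (A - W) _ hzV hz0
  have hSsymm : A.IsSymm := by rw [hA]; exact isSymm_sum_vecMulVec _ _ _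
  set μ := x ⬝ᵥ A *ᵥ x - x ⬝ᵥ W *ᵥ x with hμ
  have hform : ∀ y : Vec p, specForm (Icc 1 r) γ (fun k => WithLp.toLp 2 (v k)) (WithLp.toLp 2 y)
      (WithLp.toLp 2 y) = y ⬝ᵥ A *ᵥ y := fun y => by rw [specForm_eq, hA]
  have hγj := hD.pos j hD.mem
  have hγ1j := hD.le_first j hD.mem
  have hγ1 : 0 < γ 1 := hγj.trans_le hγ1j
  have hlast := hD.last_nonneg
  have hbG : b * (γ j - γ') ≤ 1 / 4 * (γ j - γ') := mul_le_mul_of_nonneg_right hb4.le hgap.le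
  have hbG' : b * (γ j - γ') ≤ b * γ 1 := mul_le_mul_of_nonneg_left (by linarith) hb0
  -- With index 0 the orthogonality constraints are void: V is just the space of vectors supported
  -- in J₁.
  let V : Submodule ℝ (EuclideanSpace ℝ (Coord p)) :=
    (feasible J₁ vhat 0).comap (WithLp.linearEquiv 2 ℝ (Vec p)).toLinearMap
  have hVmem : ∀ y : Vec p, WithLp.toLp 2 y ∈ V ↔ ∀ s ∉ J₁, y s = 0 := fun y =>
    ⟨fun h => h.1, fun h => ⟨h, by simp⟩⟩
  obtain ⟨hμlow, σ, hσ, hclose⟩ := hD.top_eigenvector (W := matForm W) (K := K) hK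
    (fun x y => by
      have := hWK x.ofLp y.ofLp
      rwa [l2norm_eq_norm, l2norm_eq_norm] at this)
    (V := V) ((hVmem _).2 hvJ) (fun k hk => (hVmem _).2 (huJ k hk)) (x := WithLp.toLp 2 x)
    (by rw [← l2norm_eq_norm, l2norm_eq_one_iff, hx1])
    (fun k hk => by rw [inner_toLp]; exact hxV.2 k hk) (μ := μ)
    (by rw [hform, matForm_apply])
    (fun y hyV hyu => by
      have hyV' : y.ofLp ∈ feasible J₁ vhat (j - 1) := ⟨hyV.1, fun k hk => by
        have := hyu k hk
        rwa [← WithLp.toLp_ofLp 2 y, inner_toLp] at this⟩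
      have h := hxmax _ hyV'
      rw [sub_mulVec, sub_mulVec, dotProduct_sub, dotProduct_sub, ← hμ, ← hform,
        ← norm_toLp_sq] at h
      exact h)
    hgap (by linarith)
  have hcloseE : ‖WithLp.toLp 2 x - σ • WithLp.toLp 2 (v j)‖ ≤ b := by
    refine le_of_mul_le_mul_left ?_ hgap
    linarith
  -- Here μ ≥ γ_j - D with 4D ≤ b (γ_j - γ') ≤ b γ_1, and b < 1/4 turns γ_1 b² into a multiple of
  -- γ_1 b that `hsep` covers.
  have hg : 0 < μ - (γ' + 2 * γ 1 * b ^ 2) - K := by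
    have h1 : γ 1 * b ^ 2 ≤ γ 1 * (1 / 4 * b) := by
      refine mul_le_mul_of_nonneg_left ?_ hγ1.le
      rw [sq]; exact mul_le_mul_of_nonneg_right hb4.le hb0
    have h2 : 0 ≤ γ 1 * b := by positivity
    linarith
  refine ⟨x, σ, _, hx1, hxV, ?_, hg, fun y hy => ?_⟩
  · rwa [l2norm_eq_norm, WithLp.toLp_sub, WithLp.toLp_smul]
  · exact certificate_le hSsymm hWJ huJ hxV hx1 rfl hfirst
      (fun y => by
        have := hWK y y
        rwa [← sq, l2norm_sq] at this)
      (fun y hy hxy => by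
        have := hD.specForm_compl_le (x := WithLp.toLp 2 x) (y := WithLp.toLp 2 y) hσ hcloseE hεb
          (fun k hk => by rw [inner_toLp]; exact hy k hk) (by rw [inner_toLp, hxy])
        rwa [hform, norm_toLp_sq] at this) hy

/-- The deflated penalized problem has exactly one solution, a rank one matrix supported on
`J₁ × J₁`. -/
lemma exists_unique_solution {r : ℕ} {γ : ℕ → ℝ} {v : ℕ → Vec p} {Sig1 : Mat p}
    (hv : ∀ j ∈ Icc 1 r, ∀ k ∈ Icc 1 r, v j ⬝ᵥ v k = if j = k then (1 : ℝ) else 0)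
    (hpos : ∀ j ∈ Icc 1 r, 0 < γ j) (hanti : StrictAntiOn γ (Set.Icc 1 r))
    (hSig1 : Sig1 = ∑ j ∈ Icc 1 r, γ j • vecMulVec (v j) (v j))
    (S : Mat p) {w : Fin I → Fin I → ℝ} (hw : ∀ k l, 0 < w k l) {lam β : ℝ} (hlam : 0 ≤ lam)
    (hβ : 0 < β) (hβ1 : β ≤ 1) {J₁ : Finset (Coord p)} {J₂ : Finset (Fin I)} (hJ : Covers J₂ J₁)
    {j : ℕ} (hj : j ∈ Icc 1 r) (hvJ : ∀ s ∉ J₁, v j s = 0) {vhat : ℕ → Vec p}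
    (hu : ∀ a ∈ Icc 1 (j - 1), ∀ b ∈ Icc 1 (j - 1),
      vhat a ⬝ᵥ vhat b = if a = b then (1 : ℝ) else 0)
    (huJ : ∀ k ∈ Icc 1 (j - 1), ∀ s ∉ J₁, vhat k s = 0)
    (hcond_elem : 1 / β * (normInf (S - Sig1)
        + bSeq r γ v vhat w lam β J₁ J₂ j * offElem J₁ Sig1) ≤ lam)
    (hcond_gap : 0 < gap r γ j - 4 * (lam * β * (J₁.card : ℝ)
        + lam * (1 - β) * (J₂.card : ℝ) * wMax w + γ 1 * bSeq r γ v vhat w lam β J₁ J₂ j)) :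
    ∃ x, x ⬝ᵥ x = 1 ∧ x ∈ feasible J₁ vhat (j - 1) ∧
      IsSolution S w lam β vhat j (vecMulVec x x) ∧
      ∀ H, IsSolution S w lam β vhat j H → H = vecMulVec x x := by
  have hD := deflation hv hpos hanti hj hu
  have hgap := gap_pos hpos hanti hj
  have hbound := term_le_bSeq v vhat (w := w) (lam := lam) (β := β) J₁ J₂ hpos hanti hj hw hlam
    hβ.le hβ1
  set a := lam * β with ha
  set c := lam * (1 - β) with hc
  set κ := a * (J₁.card : ℝ) + c * (J₂.card : ℝ) * wMax w with hκ
  set b := bSeq r γ v vhat w lam β J₁ J₂ j with hb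
  have ha0 : 0 ≤ a := mul_nonneg hlam hβ.le
  have hc0 : 0 ≤ c := mul_nonneg hlam (sub_nonneg.2 hβ1)
  have hκ0 : 0 ≤ 2 * κ := by have := wMax_nonneg hw; positivity
  have hsep : 2 * (2 * κ) + 4 * (γ 1 * b) < gap r γ j := by linarith
  obtain ⟨hb0, hεb, hb4⟩ := hD.bounds hκ0 hgap hbound hsep
  have hcond : normInf (S - Sig1) + b * offElem J₁ Sig1 ≤ a := by
    rw [one_div, inv_mul_le_iff₀ hβ] at hcond_elem
    rw [ha, mul_comm lam]; exact hcond_elem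
  have hE : ∀ s t, |(S - Sig1) s t| ≤ a := fun s t => by
    have := mul_nonneg hb0 (offElem_nonneg J₁ Sig1)
    linarith [abs_apply_le_normInf (S - Sig1) s t]
  obtain ⟨z, hzV, hz0⟩ := exists_mem_feasible_ne_zero hD hvJ huJ (by linarith)
  -- Applied to the zero matrix, merely to normalize a feasible vector.
  obtain ⟨y₀, hy₀V, hy₀1, -⟩ := exists_rayleigh_max (0 : Mat p) _ hzV hz0
  obtain ⟨Z, hZ, H₀, hH₀, hmaxH, hminZ⟩ := exists_saddle hw J₁ (proj vhat (j - 1)) S a c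
    ⟨vecMulVec y₀ y₀, vecMulVec_mem_deflatedFantope hy₀1 hy₀V.2, fun s t hst => by
      rcases hst with h | h <;> simp [vecMulVec_apply, hy₀V.1 _ h]⟩
  set W := dualResidual J₁ a c (S - Sig1) Z with hW
  have hWJ : ∀ s t, s ∉ J₁ ∨ t ∉ J₁ → W s t = 0 := fun s t => dualResidual_apply_of_notMem hZ
  obtain ⟨x, σ, g, hx1, hxV, hclose, hg, hMle⟩ := exists_leading_vector hD hSig1 hvJ huJ hWJ hκ0
    (fun x y => abs_dotProduct_dualResidual_le hw hJ ha0 hc0 hE hZ x y) hgap hbound hsep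
  have hSsymm : Sig1.IsSymm := by rw [hSig1]; exact isSymm_sum_vecMulVec _ _ _
  set μ := x ⬝ᵥ Sig1 *ᵥ x - x ⬝ᵥ W *ᵥ x with hμ
  set M := certificate J₁ Sig1 W x with hM
  -- Σ₁ v_j = γ_j v_j vanishes outside J₁, so there Σ₁ x equals Σ₁ (x - σ v_j), and the distance
  -- bound b applies.
  have hAx : ∀ s ∉ J₁, |(Sig1 *ᵥ x) s| ≤ b * offElem J₁ Sig1 := fun s hs => by
    have h1 : (Sig1 *ᵥ x) s = (Sig1 *ᵥ (x - σ • v j)) s := by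
      rw [mulVec_sub, mulVec_smul, hSig1, sum_vecMulVec_mulVec hv hj]
      simp [hvJ s hs]
    have h2 := abs_mulVec_le_offElem hSsymm (x := x - σ • v j)
      (fun s hs => by simp [hxV.1 s hs, hvJ s hs]) hs
    rw [h1, mul_comm]
    exact h2.trans (mul_le_mul_of_nonneg_left hclose (offElem_nonneg _ _))
  -- Inside J₁ × J₁ the remainder is a Z₁ by the choice of W. Outside, Z₂ is zero and noise plus
  -- leakage of Σ₁ x stay below λβ.
  have hMentry : ∀ s t, |(S - M - c • Z.2) s t| ≤ a := fun s t => by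
    by_cases hst : s ∈ J₁ ∧ t ∈ J₁
    · have e : (S - M - c • Z.2) s t = a * Z.1 s t := by
        simp only [Matrix.sub_apply, Matrix.smul_apply, smul_eq_mul, hM,
          certificate_apply_of_mem hst.1 hst.2, hW, dualResidual_apply_of_mem hst.1 hst.2]
        ring
      rw [e, abs_mul, abs_of_nonneg ha0]
      exact mul_le_of_le_one_right ha0 (hZ.1 s t)
    · have hst' : s ∉ J₁ ∨ t ∉ J₁ := by tauto
      have e : (S - M - c • Z.2) s t = (S - Sig1) s t + (Sig1 s t - M s t) := by
        simp only [Matrix.sub_apply, Matrix.smul_apply, smul_eq_mul, (hZ.2.2 s t hst').2]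
        ring
      have h1 := abs_certificate_sub_le hWJ hxV.1 hx1
        (mul_nonneg hb0 (offElem_nonneg J₁ Sig1)) hAx hst'
      rw [e]
      exact (abs_add_le _ _).trans (by linarith [abs_apply_le_normInf (S - Sig1) s t])
  have hobj : ∀ H, objective S w lam β H ≤ inner2 M H :=
    objective_le_inner2 hlam hβ1 hZ.2.1 hMentry
  have hAM : ∀ s ∈ J₁, ∀ t ∈ J₁, (S - a • Z.1 - c • Z.2) s t = M s t := fun s hs t ht => by
    simp only [Matrix.sub_apply, Matrix.smul_apply, smul_eq_mul, hM,
      certificate_apply_of_mem hs ht, hW, dualResidual_apply_of_mem hs ht]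
    ring
  have hxD : vecMulVec x x ∈ deflatedFantope (proj vhat (j - 1)) :=
    vecMulVec_mem_deflatedFantope hx1 hxV.2
  have hxR : ∀ s t, s ∉ J₁ ∨ t ∉ J₁ → vecMulVec x x s t = 0 := fun s t hst => by
    rcases hst with h | h <;> simp [vecMulVec_apply, hxV.1 _ h]
  have hMx : inner2 M (vecMulVec x x) = μ := by
    have hxq := dotProduct_residual hxV.1 (Sig1 *ᵥ x)
    rw [inner2_vecMulVec, hM, dotProduct_certificate,
      dotProduct_comm (Sig1 *ᵥ x - restrictVec J₁ (Sig1 *ᵥ x)), hxq, hμ]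
    ring
  -- H₀ maximizes the linearized objective, which agrees with ⟨M, ·⟩ on J₁ × J₁; uniqueness of the
  -- maximizer identifies it.
  have hH₀x : H₀ = vecMulVec x x := by
    refine (deflatedFantope_maximizer hg hx1 hMle hH₀.1).2 ?_
    have := hmaxH _ ⟨hxD, hxR⟩
    rwa [inner2_congr hAM hxR, inner2_congr hAM hH₀.2, hMx] at this
  -- Minimality of Z, tested against the dual variables attaining both penalties at x xᵀ.
  have hobjx : μ ≤ objective S w lam β (vecMulVec x x) := by
    obtain ⟨Y, hY, hY1, hY2⟩ := exists_mem_dualBall hw hxR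
    have := hminZ Y hY
    rw [hH₀x, inner2_congr hAM hxR, hMx] at this
    rwa [inner2_sub_left, inner2_sub_left, inner2_smul_left, inner2_smul_left, hY1, hY2] at this
  refine ⟨x, hx1, hxV, ⟨hxD, fun H hH => ?_⟩, fun H hH => ?_⟩
  · exact (hobj H).trans ((deflatedFantope_maximizer hg hx1 hMle hH).1.trans hobjx)
  · exact (deflatedFantope_maximizer hg hx1 hMle hH.1).2
      (hobjx.trans ((hH.2 hxD).trans (hobj H)))

/-! ### First eigenvectors of a rank one projection -/

lemma isFirstEigenvector_vecMulVec {x : Vec p} (hx : x ⬝ᵥ x = 1) :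
    IsFirstEigenvector (vecMulVec x x) x := by
  refine ⟨(l2norm_eq_one_iff x).2 hx, 1, ?_, fun ν hν => ?_⟩
  · rw [Module.End.hasEigenvector_iff, Module.End.mem_eigenspace_iff]
    refine ⟨by rw [toLin'_apply, vecMulVec_mulVec, hx]; simp, ?_⟩
    rintro rfl
    simp at hx
  · obtain ⟨y, hy⟩ := hν.exists_hasEigenvector
    have h1 := hy.apply_eq_smul
    rw [toLin'_apply] at h1
    have h2 : (x ⬝ᵥ y) ^ 2 = ν * (y ⬝ᵥ y) := by
      have := congrArg (fun u => y ⬝ᵥ u) h1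
      simp only [vecMulVec_mulVec, dotProduct_smul, dotProduct_comm y x, smul_eq_mul,
        MulOpposite.smul_eq_mul_unop, MulOpposite.unop_op] at this
      rw [sq]; exact this
    have h3 := dotProduct_sq_le x y
    have h4 : 0 < y ⬝ᵥ y := lt_of_le_of_ne (dotProduct_self_star_nonneg y)
      fun h => hy.2 (dotProduct_self_eq_zero.1 h.symm)
    rw [hx, h2] at h3
    exact le_of_mul_le_mul_right h3 h4

/-- The top eigenvalue is at least 1, hence nonzero, so u lies in the range of x xᵀ. -/
lemma eq_or_eq_neg_of_isFirstEigenvector {x u : Vec p} (hx : x ⬝ᵥ x = 1)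
    (hu : IsFirstEigenvector (vecMulVec x x) u) : u = x ∨ u = -x := by
  obtain ⟨hu1, μ, hμ, hmax⟩ := hu
  rw [l2norm_eq_one_iff] at hu1
  have h1 : 1 ≤ μ := by
    have hx0 : x ≠ 0 := by rintro rfl; simp at hx
    refine hmax 1 (Module.End.hasEigenvalue_of_hasEigenvector (x := x) ?_)
    rw [Module.End.hasEigenvector_iff, Module.End.mem_eigenspace_iff]
    exact ⟨by rw [toLin'_apply, vecMulVec_mulVec, hx]; simp, hx0⟩
  have h2 := hμ.apply_eq_smul
  rw [toLin'_apply, vecMulVec_mulVec] at h2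
  have h3 : u = ((x ⬝ᵥ u) / μ) • x := by
    have h4 : μ • u = (x ⬝ᵥ u) • x := by rw [← h2]; ext s; simp [mul_comm]
    rw [div_eq_inv_mul, mul_smul, ← h4, smul_smul, inv_mul_cancel₀ (by linarith), one_smul]
  set t := (x ⬝ᵥ u) / μ with ht
  have h5 : t ^ 2 = 1 := by
    rw [h3, smul_dotProduct, dotProduct_smul, hx] at hu1
    simpa [sq] using hu1
  rcases sq_eq_one_iff.1 h5 with h | h
  · left; rw [h3, h, one_smul]
  · right; rw [h3, h, neg_one_smul]

end SIPCA

end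

/-! ### Induction over the deflation steps -/

theorem proposition2 {I : ℕ} (p : Fin I → ℕ)
    -- the signal covariance and its eigendecomposition
    (r : ℕ) (γ : ℕ → ℝ) (v : ℕ → SIPCA.Vec p) (Sig1 : SIPCA.Mat p)
    (hv : ∀ j ∈ Finset.Icc 1 r, ∀ k ∈ Finset.Icc 1 r,
      v j ⬝ᵥ v k = if j = k then (1 : ℝ) else 0)
    (hγ_pos : ∀ j ∈ Finset.Icc 1 r, 0 < γ j)
    (hγ_anti : StrictAntiOn γ (Set.Icc 1 r))
    (hSig1 : Sig1 = ∑ j ∈ Finset.Icc 1 r, γ j • Matrix.vecMulVec (v j) (v j))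
    -- the denoised sample covariance, the weights and the tuning parameters
    (S : SIPCA.Mat p) (hS : S.IsSymm)
    (w : Fin I → Fin I → ℝ) (hw : ∀ k l, 0 < w k l)
    (lam β : ℝ) (hlam : 0 ≤ lam) (hβ_pos : 0 < β) (hβ_le : β ≤ 1)
    -- the union supports of the first `r₁` eigenvectors
    (r₁ : ℕ) (hr₁ : r₁ ≤ r)
    (J₁ : Finset (SIPCA.Coord p)) (hJ₁ : J₁ = SIPCA.elemUnion v r₁)
    (J₂ : Finset (Fin I)) (hJ₂ : J₂ = SIPCA.blockUnion v r₁)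
    -- the step `j` and the estimates of the previous steps
    (j : ℕ) (hj : j ∈ Finset.Icc 1 r₁) (vhat : ℕ → SIPCA.Vec p)
    (hvhat : ∀ k, 1 ≤ k → k < j → SIPCA.IsEstimate S w lam β vhat k (vhat k))
    -- the three conditions up to step `j`
    (hcond_block : ∀ i ∈ Finset.Icc 1 j,
      (if β ≠ 1 then
          SIPCA.normInfStar w (S - Sig1)
            + SIPCA.bSeq r γ v vhat w lam β J₁ J₂ i * SIPCA.offBlock w J₂ Sig1
        else 0) ≤ SIPCA.wMin w / SIPCA.wMax w * lam)
    (hcond_elem : ∀ i ∈ Finset.Icc 1 j,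
      1 / β * (SIPCA.normInf (S - Sig1)
        + SIPCA.bSeq r γ v vhat w lam β J₁ J₂ i * SIPCA.offElem J₁ Sig1) ≤ lam)
    (hcond_gap : ∀ i ∈ Finset.Icc 1 j,
      0 < SIPCA.gap r γ i - 4 * (lam * β * (J₁.card : ℝ)
        + lam * (1 - β) * (J₂.card : ℝ) * SIPCA.wMax w
        + γ 1 * SIPCA.bSeq r γ v vhat w lam β J₁ J₂ i)) :
    -- the `j`-th problem has exactly one solution,
    (∃! H, SIPCA.IsSolution S w lam β vhat j H) ∧
    -- the `j`-th estimate exists and is unique up to its sign,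
    (∃ u, SIPCA.IsEstimate S w lam β vhat j u ∧
      ∀ u', SIPCA.IsEstimate S w lam β vhat j u' → u' = u ∨ u' = -u) ∧
    -- and its supports lie in the union supports
    (∀ u, SIPCA.IsEstimate S w lam β vhat j u →
      SIPCA.elemSupp u ⊆ J₁ ∧ SIPCA.blockSupp u ⊆ J₂) := by
  have hcov : SIPCA.Covers J₂ J₁ := by rw [hJ₁, hJ₂]; exact SIPCA.covers_blockUnion v r₁
  have key : ∀ i, i ∈ Finset.Icc 1 j → ∃ x, x ⬝ᵥ x = 1 ∧ x ∈ SIPCA.feasible J₁ vhat (i - 1) ∧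
      SIPCA.IsSolution S w lam β vhat i (Matrix.vecMulVec x x) ∧
      ∀ H, SIPCA.IsSolution S w lam β vhat i H → H = Matrix.vecMulVec x x := by
    intro i
    induction i using Nat.strong_induction_on with
    | _ i ih =>
      intro hi
      rw [Finset.mem_Icc] at hi hj
      -- Each earlier estimate is ± the vector found at its step: unit, supported in J₁ and
      -- orthogonal to its predecessors. Pairwise orthogonality follows by looking at the larger
      -- index.
      have hprev : ∀ k ∈ Finset.Icc 1 (i - 1),
          vhat k ⬝ᵥ vhat k = 1 ∧ vhat k ∈ SIPCA.feasible J₁ vhat (k - 1) := fun k hk => by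
        rw [Finset.mem_Icc] at hk
        obtain ⟨x, hx1, hxV, -, huniq⟩ := ih k (by omega) (Finset.mem_Icc.2 ⟨hk.1, by omega⟩)
        obtain ⟨H, hH, hHu⟩ := hvhat k hk.1 (by omega)
        rw [huniq H hH] at hHu
        rcases SIPCA.eq_or_eq_neg_of_isFirstEigenvector hx1 hHu with h | h
        · rw [h]; exact ⟨hx1, hxV⟩
        · rw [h]; exact ⟨by simpa using hx1, neg_mem hxV⟩
      refine SIPCA.exists_unique_solution hv hγ_pos hγ_anti hSig1 S hw hlam hβ_pos hβ_le hcov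
        (Finset.mem_Icc.2 ⟨hi.1, by omega⟩) ?_ (fun a ha b hb => ?_) (fun k hk => (hprev k hk).2.1)
        (hcond_elem i (Finset.mem_Icc.2 hi)) (hcond_gap i (Finset.mem_Icc.2 hi))
      · rw [← SIPCA.elemSupp_subset_iff, hJ₁]
        exact Finset.subset_biUnion_of_mem (fun j => SIPCA.elemSupp (v j))
          (Finset.mem_Icc.2 ⟨hi.1, by omega⟩)
      · have ha' := Finset.mem_Icc.1 ha
        have hb' := Finset.mem_Icc.1 hb
        rcases lt_trichotomy a b with h | h | h
        · rw [if_neg h.ne]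
          exact (hprev b hb).2.2 a (Finset.mem_Icc.2 ⟨ha'.1, by omega⟩)
        · rw [if_pos h, h]; exact (hprev b hb).1
        · rw [if_neg h.ne', dotProduct_comm]
          exact (hprev a ha).2.2 b (Finset.mem_Icc.2 ⟨hb'.1, by omega⟩)
  obtain ⟨x, hx1, hxV, hsol, huniq⟩ := key j (Finset.mem_Icc.2 ⟨(Finset.mem_Icc.1 hj).1, le_rfl⟩)
  have hest : ∀ u, SIPCA.IsEstimate S w lam β vhat j u → u = x ∨ u = -x := by
    rintro u ⟨H, hH, hHu⟩
    rw [huniq H hH] at hHu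
    exact SIPCA.eq_or_eq_neg_of_isFirstEigenvector hx1 hHu
  refine ⟨⟨_, hsol, huniq⟩, ⟨x, ⟨_, hsol, SIPCA.isFirstEigenvector_vecMulVec hx1⟩, hest⟩,
    fun u hu => ?_⟩
  have huJ : ∀ s ∉ J₁, u s = 0 := by
    rcases hest u hu with h | h
    · rw [h]; exact hxV.1
    · rw [h]; exact (neg_mem hxV : -x ∈ SIPCA.feasible J₁ vhat (j - 1)).1
  exact ⟨SIPCA.elemSupp_subset_iff.2 huJ, SIPCA.blockSupp_subset hcov huJ⟩
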